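/- **Setting.** Let $\hat{\mathfrak h}$ be the rank one Heisenberg Lie algebra with basis $h(n)$ $(n\in\mathbb Z)$, $K$ and brackets $[h(m),h(n)]=m\,\delta_{m+n,0}K$, $K$ central. For $\lambda\in\mathbb C$ let $M(1,\lambda)=\mathbb C[h(-1),h(-2),\dots]\otimes e^{\lambda}$ be its Fock space: $K=1$, $h(0)=\lambda$, $h(-n)$ acts by multiplication and $h(n)$ by $n\,\partial/\partial h(-n)$ for $n>0$. Let $P:M(1,\mu)\to M(1,\lambda+\mu)$ be $u\otimes e^\mu\mapsto u\otimes e^{\lambda+\mu}$, let $h(z)=\sum_{n\in\mathbb Z}h(n)z^{-n-1}$ and $\partial^{(n)}=\frac1{n!}\left(\frac{d}{dz}\right)^n$, and set $$I_{\lambda\mu}(e^\lambda,z)=\exp\Big(\sum_{n>0}\tfrac{\lambda h(-n)}{n}z^n\Big)\exp\Big(-\sum_{n>0}\tfrac{\lambda h(n)}{n}z^{-n}\Big)P\,z^{\lambda\mu},$$ $$I_{\lambda\mu}(h(-n_1)\cdots h(-n_k)e^\lambda,z)={:}\,\partial^{(n_1-1)}h(z)\cdots\partial^{(n_k-1)}h(z)\,I_{\lambda\mu}(e^\lambda,z)\,{:}\qquad(n_i>0),$$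 extended linearly to $M(1,\lambda)$, where the normal ordering puts $h(n)$ $(n<0)$ and $P$ to the left of $h(n)$ $(n\ge 0)$. The free bosonic vertex operator algebra is $M(1)=M(1,0)$ with vertex operator $I_{00}$, vacuum $\mathbf 1=e^0$ and conformal vector $\omega=\frac12h(-1)^2\mathbf 1$. Let $M(1)^+$ be the fixed points in $M(1)$ of $\theta:h(-n_1)\cdots h(-n_k)\mathbf 1\mapsto(-1)^kh(-n_1)\cdots h(-n_k)\mathbf 1$. Each $M(1,\lambda)$ is an $M(1)^+$-module with $Y_{M(1,\lambda)}(a,z)=I_{0\lambda}(a,z)$ for $a\in M(1)^+$. For modules $M^1,M^2,M^3$ over a vertex operator algebra $V$, an *intertwining operator of type* $\binom{M^3}{M^1\,M^2}$ is a linear map $v\mapsto I(v,z)=\sum_{n\in\mathbb C}v_nz^{-n-1}$, $v_n\in\mathrm{Hom}(M^2,M^3)$, on $M^1$ such that for all $a\in V$, $v\in M^1$, $u\in M^2$: for each $n\in\mathbb C$, $v_{n+k}u=0$ for all sufficiently large integers $k$; the Jacobi identity $$z_0^{-1}\delta\big(\tfrac{z_1-z_2}{z_0}\big)Y_{M^3}(a,z_1)I(v,z_2)-z_0^{-1}\delta\big(\tfrac{z_2-z_1}{-z_0}\big)I(v,z_2)Y_{M^2}(a,z_1)=z_2^{-1}\delta\big(\tfrac{z_1-z_0}{z_2}\big)I(Y_{M^1}(a,z_0)v,z_2)$$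 holds; and $\frac{d}{dz}I(v,z)=I(L(-1)v,z)$, where $L(-1)=\omega_0$ is the coefficient of $z^{-1}$ in $Y_{M^1}(\omega,z)$. The *fusion rule* $N_{M^1M^2}^{M^3}$ is the dimension of the space of these operators. **Proposition.** Let $\lambda,\mu,\nu\in\mathbb C$, and regard all $M(1,\cdot)$ as $M(1)^+$-modules. 1. If $\nu^2=(\lambda+\mu)^2$ or $\nu^2=(\lambda-\mu)^2$, then $N_{M(1,\lambda)M(1,\mu)}^{M(1,\nu)}\neq0$. 2. $I_{\lambda\mu}$ is a nonzero intertwining operator of type $\binom{M(1,\lambda+\mu)}{M(1,\lambda)\,M(1,\mu)}$, and $M(1,\mu)\cong M(1,-\mu)$. 3. If $\nu^2=(\lambda+\mu)^2$, then $M(1,\lambda+\mu)\cong M(1,\nu)$, and for every isomorphism $g:M(1,\lambda+\mu)\to M(1,\nu)$ the map $v\mapsto g\circ I_{\lambda\mu}(v,z)$ is a nonzero intertwining operator of type $\binom{M(1,\nu)}{M(1,\lambda)\,M(1,\mu)}$. 4. If $\nu^2=(\lambda-\mu)^2$, then $M(1,\lambda-\mu)\cong M(1,\nu)$, and for all isomorphisms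 $f:M(1,\mu)\to M(1,-\mu)$ and $g:M(1,\lambda-\mu)\to M(1,\nu)$ the map $v\mapsto g\circ I_{\lambda,-\mu}(v,z)\circ f$ is a nonzero intertwining operator of type $\binom{M(1,\nu)}{M(1,\lambda)\,M(1,\mu)}$. -/

import Mathlib

/-! # Intertwining operators and fusion rules

A vertex operator `Y(a, z) = ∑ a_n z^{-n-1}` on a module `M` is stored as its family of modes,
`Y a n = a_n`, with `n : ℤ`.  An element `∑ v_n z^{-n-1}` of `Hom(M₂, M₃){z}`, with complex powers
of `z`, is stored as the function `n ↦ v_n` on `ℂ`. -/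

namespace FreeBoson

open Filter

noncomputable section

section Intertwining

variable {V M₁ M₂ M₃ : Type*}
  [AddCommGroup V] [Module ℂ V] [AddCommGroup M₁] [Module ℂ M₁]
  [AddCommGroup M₂] [Module ℂ M₂] [AddCommGroup M₃] [Module ℂ M₃]

/-- The Jacobi identity of an intertwining operator,
`z₀⁻¹ δ((z₁-z₂)/z₀) Y₃(a,z₁) I(v,z₂) u - z₀⁻¹ δ((z₂-z₁)/(-z₀)) I(v,z₂) Y₂(a,z₁) u`
`= z₂⁻¹ δ((z₁-z₀)/z₂) I(Y₁(a,z₀)v,z₂) u`,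
read off at the coefficient of `z₀^{-l-1} z₁^{-m-1} z₂^{-n-1}` for all `l m : ℤ`, `n : ℂ`.
Each of the sums over `i` has only finitely many nonzero terms when `Y₁`, `Y₂`, `I` are truncated
from below, so it is the common value of all sufficiently long partial sums. -/
def JacobiIdentity (Y₁ : V →ₗ[ℂ] ℤ → Module.End ℂ M₁) (Y₂ : V →ₗ[ℂ] ℤ → Module.End ℂ M₂)
    (Y₃ : V →ₗ[ℂ] ℤ → Module.End ℂ M₃) (I : M₁ →ₗ[ℂ] ℂ → M₂ →ₗ[ℂ] M₃) : Prop :=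
  ∀ (a : V) (v : M₁) (u : M₂) (l m : ℤ) (n : ℂ), ∀ᶠ N : ℕ in atTop,
    (∑ i ∈ Finset.range N, ((-1 : ℂ) ^ i * (Ring.choose l i : ℤ)) •
        Y₃ a (m + l - i) (I v (n + i) u))
      - (∑ i ∈ Finset.range N, ((-1 : ℂ) ^ l * (-1 : ℂ) ^ i * (Ring.choose l i : ℤ)) •
        I v (n + l - i) (Y₂ a (m + i) u))
    = ∑ i ∈ Finset.range N, ((Ring.choose m i : ℤ) : ℂ) • I (Y₁ a (l + i) v) (m + n - i) u

/-- The space of intertwining operators of type `(M₃ over M₁ M₂)`, for modules `Mᵢ` with vertex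
operators `Yᵢ` over a vertex operator algebra `V` with conformal vector `ω`: lower truncation,
the Jacobi identity, and `d/dz I(v, z) = I(L(-1)v, z)`, where `L(-1) = ω_0`. -/
def intertwiningSpace (ω : V) (Y₁ : V →ₗ[ℂ] ℤ → Module.End ℂ M₁)
    (Y₂ : V →ₗ[ℂ] ℤ → Module.End ℂ M₂) (Y₃ : V →ₗ[ℂ] ℤ → Module.End ℂ M₃) :
    Submodule ℂ (M₁ →ₗ[ℂ] ℂ → M₂ →ₗ[ℂ] M₃) where
  carrier := {I |
    (∀ (v : M₁) (u : M₂) (n : ℂ), ∀ᶠ k : ℕ in atTop, I v (n + k) u = 0) ∧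
    JacobiIdentity Y₁ Y₂ Y₃ I ∧
    (∀ (v : M₁) (n : ℂ), I (Y₁ ω 0 v) n = (-n) • I v (n - 1))}
  zero_mem' := by
    refine ⟨fun v u n => ?_, fun a v u l m n => ?_, fun v n => ?_⟩ <;> simp
  add_mem' := by
    rintro I J ⟨hI₁, hI₂, hI₃⟩ ⟨hJ₁, hJ₂, hJ₃⟩
    refine ⟨fun v u n => ?_, fun a v u l m n => ?_, fun v n => ?_⟩
    · filter_upwards [hI₁ v u n, hJ₁ v u n] with k h1 h2
      simp [h1, h2]
    · filter_upwards [hI₂ a v u l m n, hJ₂ a v u l m n] with N h1 h2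
      simp only [LinearMap.add_apply, Pi.add_apply, map_add, smul_add, Finset.sum_add_distrib,
        ← h1, ← h2]
      abel
    · simp [hI₃ v n, hJ₃ v n]
  smul_mem' := by
    rintro c I ⟨hI₁, hI₂, hI₃⟩
    refine ⟨fun v u n => ?_, fun a v u l m n => ?_, fun v n => ?_⟩
    · filter_upwards [hI₁ v u n] with k h1
      simp [h1]
    · filter_upwards [hI₂ a v u l m n] with N h1
      simp only [LinearMap.smul_apply, Pi.smul_apply, map_smul, smul_comm _ c,
        ← Finset.smul_sum, ← smul_sub, h1]
    · simp [hI₃ v n, smul_comm c n]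

/-- The fusion rule: the dimension of the space of intertwining operators. -/
def fusionRule (ω : V) (Y₁ : V →ₗ[ℂ] ℤ → Module.End ℂ M₁)
    (Y₂ : V →ₗ[ℂ] ℤ → Module.End ℂ M₂) (Y₃ : V →ₗ[ℂ] ℤ → Module.End ℂ M₃) : Cardinal :=
  Module.rank ℂ (intertwiningSpace ω Y₁ Y₂ Y₃)

/-- A linear isomorphism is an isomorphism of modules if it commutes with all modes. -/
def IsModuleIso (Y₁ : V →ₗ[ℂ] ℤ → Module.End ℂ M₁) (Y₂ : V →ₗ[ℂ] ℤ → Module.End ℂ M₂)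
    (f : M₁ ≃ₗ[ℂ] M₂) : Prop :=
  ∀ (a : V) (n : ℤ) (u : M₁), f (Y₁ a n u) = Y₂ a n (f u)

/-- `(I, f, g) ↦ (v ↦ g ∘ I(v, z) ∘ f)`. -/
def compose {N₂ N₃ : Type*} [AddCommGroup N₂] [Module ℂ N₂] [AddCommGroup N₃] [Module ℂ N₃]
    (g : M₃ →ₗ[ℂ] N₃) (I : M₁ →ₗ[ℂ] ℂ → M₂ →ₗ[ℂ] M₃) (f : N₂ →ₗ[ℂ] M₂) :
    M₁ →ₗ[ℂ] ℂ → N₂ →ₗ[ℂ] N₃ where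
  toFun v n := g ∘ₗ I v n ∘ₗ f
  map_add' v w := by ext; simp
  map_smul' c v := by ext; simp

end Intertwining

/-! # The Fock spaces and the lattice-type vertex operators (rank one) -/

/-- The Fock space `M(1, lam) = S(𝔥 ⊗ t⁻¹ℂ[t⁻¹]) ⊗ ℂ e^lam` for `𝔥 = ℂ h`, `⟨h, h⟩ = 1`.  The
variable `X i` stands for `h(-(i+1))` and the polynomial `1` for `e^lam`.  On `M(1, lam)` the
Heisenberg algebra acts by `h(-(i+1)) =` multiplication by `X i`, `h(i+1) = (i+1) ∂/∂X i` and
`h(0) = lam`. -/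
abbrev M1 (_lam : ℂ) : Type := MvPolynomial ℕ ℂ

/-- `M(1, mu) ⊗ ℂ[z⁻¹]`, i.e. polynomials in the `X i` with coefficients in `ℂ[z⁻¹]`. The variable
of `Polynomial ℂ` stands for `z⁻¹`. -/
abbrev M1Neg (_mu : ℂ) : Type := MvPolynomial ℕ (Polynomial ℂ)

/-- The operator `∑_{i ≥ 0} c_i h(i+1)` on `M(1, mu) ⊗ ℂ[z⁻¹]`, where `c_i ∈ ℂ[z⁻¹]` and
`h(i+1) = (i+1) ∂/∂X i`: the derivation with `X i ↦ (i+1) c_i`. -/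
def annihilation (mu : ℂ) (c : ℕ → Polynomial ℂ) : Module.End (Polynomial ℂ) (M1Neg mu) :=
  (MvPolynomial.mkDerivation (Polynomial ℂ)
    (fun i : ℕ => MvPolynomial.C (((i : Polynomial ℂ) + 1) * c i) : ℕ → M1Neg mu)).toLinearMap

/-- The exponential `∑_k D^k / k!` of an operator `D` that lowers the degree in the `X i` by one, so
that on a monomial only the terms with `k` at most its degree are nonzero. -/
def expLowering (mu : ℂ) (D : Module.End (Polynomial ℂ) (M1Neg mu)) :
    Module.End (Polynomial ℂ) (M1Neg mu) :=
  (MvPolynomial.basisMonomials ℕ (Polynomial ℂ)).constr (Polynomial ℂ) fun s =>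
    ∑ k ∈ Finset.range (s.degree + 1),
      ((k.factorial : ℂ)⁻¹) • (D ^ k) (MvPolynomial.monomial s 1)

/-- `exp(-∑_{n>0} (lam h(n) / n) z^{-n})`. -/
def expPlus (lam mu : ℂ) : Module.End (Polynomial ℂ) (M1Neg mu) :=
  expLowering mu (annihilation mu fun i =>
    Polynomial.monomial (i + 1) (-lam / ((i : ℂ) + 1)))

/-- `exp(∑_{n>0} (lam h(-n) / n) z^n)`, a power series in `z` whose coefficients are
(multiplication operators by) polynomials in the `h(-n)`. -/
def expMinus (lam mu : ℂ) : PowerSeries (M1 (lam + mu)) :=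
  (PowerSeries.exp ℂ).subst
    (PowerSeries.X * PowerSeries.mk fun i : ℕ =>
      (lam / ((i : ℂ) + 1)) • (MvPolynomial.X i : M1 (lam + mu)))

/-- The part of `∂^{(i)} h(z) = (1/i!) (d/dz)^i ∑_m h(m) z^{-m-1}` with `m < 0`; the coefficient
of `z^k` comes from `m = -(k+i+1)`. -/
def fieldMinus (nu : ℂ) (i : ℕ) : PowerSeries (M1 nu) :=
  PowerSeries.mk fun k => ((k + i).choose i : ℂ) • MvPolynomial.X (k + i)

/-- The part of `∂^{(i)} h(z) = (1/i!) (d/dz)^i ∑_m h(m) z^{-m-1}` with `m ≥ 0`, on `M(1, mu)`: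
`mu * binom(-1, i) z^{-i-1} + ∑_{p ≥ 0} binom(-p-2, i) h(p+1) z^{-p-i-2}`. -/
def fieldPlus (mu : ℂ) (i : ℕ) : Module.End (Polynomial ℂ) (M1Neg mu) :=
  (Polynomial.monomial (i + 1) (mu * (Ring.choose (-1 : ℤ) i : ℤ))) • LinearMap.id
    + annihilation mu fun p =>
        Polynomial.monomial (p + i + 2) ((Ring.choose (-(p : ℤ) - 2) i : ℤ) : ℂ)

theorem smul_series (nu c : ℂ) (f : LaurentSeries (M1 nu)) :
    c • f = HahnSeries.C (MvPolynomial.C c) * f := by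
  rw [HahnSeries.C_mul_eq_smul]
  ext k : 2
  rw [HahnSeries.coeff_smul, HahnSeries.coeff_smul, MvPolynomial.smul_eq_C_mul, smul_eq_mul]

/-- Multiplication by a Laurent series in `z`. -/
def mulSeries (nu : ℂ) (g : LaurentSeries (M1 nu)) :
    LaurentSeries (M1 nu) →ₗ[ℂ] LaurentSeries (M1 nu) where
  toFun f := g * f
  map_add' := mul_add g
  map_smul' c f := by
    rw [RingHom.id_apply, smul_series, smul_series, mul_left_comm]

/-- The map `P : M(1, mu) → M(1, lam + mu)`, `u ⊗ e^mu ↦ u ⊗ e^{lam+mu}`, extended to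
`M(1, mu) ⊗ ℂ[z⁻¹]`, with values in `M(1, lam + mu)((z))`. -/
def shift (lam mu : ℂ) : M1Neg mu →ₗ[ℂ] LaurentSeries (M1 (lam + mu)) where
  toFun := MvPolynomial.eval₂
    (Polynomial.eval₂RingHom (HahnSeries.C.comp MvPolynomial.C)
      (HahnSeries.single (-1 : ℤ) (1 : M1 (lam + mu))))
    (fun i => HahnSeries.C (MvPolynomial.X i))
  map_add' := by intro x y; simp
  map_smul' := by
    intro c x
    have h : c • x = MvPolynomial.C (Polynomial.C c) * x := by
      rw [← MvPolynomial.smul_eq_C_mul]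
      ext
      simp
    rw [RingHom.id_apply, smul_series, h, MvPolynomial.eval₂_mul, MvPolynomial.eval₂_C]
    simp

/-- The normally ordered product `: ∂^{(i₁)}h(z) ⋯ ∂^{(i_k)}h(z) I(e^lam, z) :` without its factor
`z^{lam * mu}`.  Normal ordering puts the `m < 0` part of each `∂^{(i)}h(z)` to the left of
everything that follows and its `m ≥ 0` part to the right of it. -/
def normalOrdered (lam mu : ℂ) : List ℕ → M1Neg mu →ₗ[ℂ] LaurentSeries (M1 (lam + mu))
  | [] => mulSeries (lam + mu) (HahnSeries.ofPowerSeries ℤ _ (expMinus lam mu))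
      ∘ₗ shift lam mu ∘ₗ (expPlus lam mu).restrictScalars ℂ
  | i :: t =>
      mulSeries (lam + mu) (HahnSeries.ofPowerSeries ℤ _ (fieldMinus (lam + mu) i))
          ∘ₗ normalOrdered lam mu t
        + normalOrdered lam mu t ∘ₗ (fieldPlus mu i).restrictScalars ℂ

/-- `z^{-lam * mu} I_{lam,mu}(v, z) u`, a Laurent series in `z`.  On the basis vectors
`v = h(-n₁) ⋯ h(-n_k) e^lam` it is `: ∂^{(n₁-1)}h(z) ⋯ ∂^{(n_k-1)}h(z) I(e^lam, z) : u`, and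
it is extended linearly in `v`. -/
def latticeSeries (lam mu : ℂ) :
    M1 lam →ₗ[ℂ] M1 mu →ₗ[ℂ] LaurentSeries (M1 (lam + mu)) :=
  (MvPolynomial.basisMonomials ℕ ℂ).constr ℂ fun s =>
    normalOrdered lam mu ((Finsupp.toMultiset s).sort (· ≤ ·))
      ∘ₗ (MvPolynomial.mapAlgHom (Algebra.ofId ℂ (Polynomial ℂ))).toLinearMap

/-- The coefficient of `z^k` as a linear map. -/
def coeffLin (nu : ℂ) (k : ℤ) : LaurentSeries (M1 nu) →ₗ[ℂ] M1 nu where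
  toFun f := f.coeff k
  map_add' _ _ := by simp
  map_smul' _ _ := by simp

open Classical in
/-- The vertex operator `I_{lam,mu}(v, z) = ∑_n v_n z^{-n-1}`: `v_n` is the coefficient of `z^k` in
`z^{-lam * mu} I_{lam,mu}(v, z)` if `lam * mu + k = -n - 1` with an integer `k`, and `0`
if there is no such integer. -/
def latticeVertexOperator (lam mu : ℂ) : M1 lam →ₗ[ℂ] ℂ → M1 mu →ₗ[ℂ] M1 (lam + mu) where
  toFun v n :=
    if hk : ∃ k : ℤ, lam * mu + k = -n - 1 then
      coeffLin (lam + mu) hk.choose ∘ₗ latticeSeries lam mu v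
    else 0
  map_add' v w := by
    funext n
    by_cases hk : ∃ k : ℤ, lam * mu + k = -n - 1 <;> simp [hk, LinearMap.comp_add]
  map_smul' c v := by
    funext n
    by_cases hk : ∃ k : ℤ, lam * mu + k = -n - 1 <;> simp [hk, LinearMap.comp_smul]

/-! # The orbifold `M(1)^+` and its modules -/

/-- The involution `h(-n₁) ⋯ h(-n_k) 1 ↦ (-1)^k h(-n₁) ⋯ h(-n_k) 1` of `M(1) = M(1, 0)`. -/
def theta : M1 0 →ₐ[ℂ] M1 0 := MvPolynomial.aeval fun i => -MvPolynomial.X i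

/-- `M(1)^+`, the fixed points of `theta` in `M(1)`. -/
def M1Plus : Submodule ℂ (M1 0) := LinearMap.eqLocus theta.toLinearMap LinearMap.id

/-- The conformal vector `ω = (1/2) h(-1)² 1` of `M(1)^+`. -/
def omega : M1Plus :=
  ⟨(1 / 2 : ℂ) • (MvPolynomial.X 0 : M1 0) ^ 2, by
    simp [M1Plus, theta]⟩

/-- `M(1, mu)` as an `M(1)^+`-module: `a ∈ M(1)^+` acts through `Y(a, z) = I_{0,mu}(a, z)`, which has
only integral powers of `z`. -/
def moduleY (mu : ℂ) : M1Plus →ₗ[ℂ] ℤ → Module.End ℂ (M1 mu) where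
  toFun a n := latticeVertexOperator 0 mu (a : M1 0) n
  map_add' a b := by funext n; simp
  map_smul' c a := by funext n; simp

/-- The space of intertwining operators of type `(M(1,nu) over M(1,lam) M(1,mu))` among
`M(1)^+`-modules. -/
def intertwining (lam mu nu : ℂ) : Submodule ℂ (M1 lam →ₗ[ℂ] ℂ → M1 mu →ₗ[ℂ] M1 nu) :=
  intertwiningSpace omega (moduleY lam) (moduleY mu) (moduleY nu)

end

end FreeBoson

open FreeBoson

/-! The Fock space `M(1, mu)` is modelled by polynomials in the `X i = h(-i-1)`, and all the
operators `I(v, z)` are generated from `I(e^lam, z)` by the rule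
`I(h(-j-1)v, z) = :∂^{(j)}h(z) I(v, z):` (`latticeVertexOperator_X_mul`). The Jacobi identity holds
more generally for all `a ∈ M(1)` acting through `fockMode`, and can therefore be proved by
induction on `a`, which would not be possible inside `M(1)^+`.

* For `a = 1` it is the three-term identity of formal delta functions (`delta_identity`).
* If it holds for `b`, it holds for `h(-j-1)b` (`jacobi_step`). The fields of `h(-j-1)b` on the
  three modules are the normally ordered products of `∂^{(j)}h(z)` with those of `b`. Moving the
  modes of `h(z)` past `I(v, z)` shows that each of the three terms of the identity satisfies the
  same recursion `stepTerm`, in which `h` acts on the value, on `u` and on `v`. This uses only the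
  commutator formula `[h(m), I(v, z)] = ∑ₛ C(m, s) z^{m-s} I(h(s)v, z)`, the normal ordering rule
  for `I` and convolution identities for binomial coefficients.

The commutator formula (`hasCommutatorFormula_latticeVertexOperator`) is proved by induction on `v`
from `[h(m), I(e^lam, z)] = lam z^m I(e^lam, z)`, and the derivative property
(`latticeVertexOperator_translation`) by induction on `v` from
`d/dz I(e^lam, z) = lam :h(z) I(e^lam, z):`, since `L(-1) e^lam = lam h(-1) e^lam` and
`[L(-1), h(-j-1)] = (j+1) h(-j-2)`. On the exponentials defining `I(e^lam, z)` these two relations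
say that `expPlus` is the substitution `X i ↦ X i - lam z^{-i-1}` (`expPlus_X_mul`) and that
`expMinus` satisfies its first-order differential equation (`mul_vacuumCoeff_one`).

The operator is nonzero because the leading coefficient of `I(e^lam, z) e^mu` is `e^{lam+mu}`. The
sign change `h(-n) ↦ -h(-n)` intertwines the action of `a` on `M(1, mu)` with that of `theta a` on
`M(1, -mu)` (`theta_fockMode`), so it is an isomorphism of `M(1)^+`-modules. Composing with
isomorphisms preserves intertwining operators, which gives the remaining claims. -/

namespace FreeBoson

open Filter Finset.HasAntidiagonal

/-! ### Binomial coefficients -/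

/-- The binomial coefficient `x (x - 1) ⋯ (x - i + 1) / i!` of an integer `x`, as a complex
number. -/
noncomputable def binom (x : ℤ) (i : ℕ) : ℂ := ((Ring.choose x i : ℤ) : ℂ)

theorem binom_zero_right (x : ℤ) : binom x 0 = 1 := by simp [binom]

theorem binom_natCast (n i : ℕ) : binom n i = (n.choose i : ℂ) := by
  rw [binom, Ring.choose_natCast]; simp

theorem binom_neg_succ (n i : ℕ) : binom (-(n : ℤ) - 1) i = (-1) ^ i * ((n + i).choose i : ℂ) := by
  have h : Ring.choose (-(n : ℤ) - 1) i = (-1) ^ i * ((n + i).choose i : ℤ) := by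
    rw [show -(n : ℤ) - 1 = -((n : ℤ) + 1) by ring, Ring.choose_neg,
      show (n : ℤ) + 1 + i - 1 = ((n + i : ℕ) : ℤ) by push_cast; ring, Ring.choose_natCast,
      Units.smul_def]
    simp only [smul_eq_mul, Int.coe_negOnePow_natCast]
  rw [binom, h]
  push_cast
  ring

theorem binom_add (x y : ℤ) (n : ℕ) :
    binom (x + y) n = ∑ p ∈ antidiagonal n, binom x p.1 * binom y p.2 := by
  simp only [binom, Ring.add_choose_eq n (Commute.all x y)]
  push_cast
  rfl

theorem choose_mul_binom (x : ℤ) (k j : ℕ) :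
    ((k + j).choose j : ℂ) * binom x (k + j) = binom x j * binom (x - j) k := by
  have h := Ring.choose_smul_choose x (Nat.le_add_left j k)
  rw [Nat.add_sub_cancel] at h
  simp only [binom]
  rw [← Int.cast_mul, ← h]
  simp

theorem choose_mul_choose_add (k j t : ℕ) :
    (((k + j).choose j : ℕ) : ℂ) * ((t + (k + j)).choose (k + j) : ℕ)
      = ((t + k + j).choose j : ℕ) * ((t + k).choose k : ℕ) := by
  have h := Nat.choose_mul (n := t + k + j) (k := k + j) (s := j) (Nat.le_add_left j k)
  rw [Nat.add_sub_cancel, Nat.add_sub_cancel] at h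
  rw [← add_assoc, mul_comm]
  exact_mod_cast h

/-- Both sides equal `(-1) ^ j (s + t + j)! / (j! s! t!)`. -/
theorem binom_mul_choose (s t j : ℕ) :
    binom (-((s + t : ℕ) : ℤ) - 1) j * ((s + t).choose s : ℂ)
      = binom (-(s : ℤ) - 1) j * ((-1) ^ t * binom (-(s : ℤ) - j - 1) t) := by
  rw [binom_neg_succ, binom_neg_succ, show -(s : ℤ) - j - 1 = -((s + j : ℕ) : ℤ) - 1 by
    push_cast; ring, binom_neg_succ]
  have h := choose_mul_choose_add s j t
  have h' := choose_mul_choose_add j s t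
  have h1 : (t + s).choose s = (s + t).choose s := by rw [add_comm]
  have h2 : (j + s).choose s = (s + j).choose j := by
    rw [add_comm, Nat.choose_symm_add]
  have h3 : (t + (s + j)).choose (s + j) = (s + j + t).choose t := by
    rw [add_comm, Nat.choose_symm_add]
  have h4 : t + s + j = s + t + j := by ring
  rw [h3, h4, h1] at h
  have h5 : ((-1 : ℂ) ^ t) * (-1) ^ t = 1 := by rw [← mul_pow]; simp
  linear_combination (-(-1 : ℂ) ^ j) * h - (-1) ^ j * ((s + j).choose j : ℂ) *
    ((s + j + t).choose t : ℂ) * h5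

/-- Coefficientwise form of `(1 - x) ^ l ∑ₜ C(-s-t-1, j) C(s+t, s) x ^ t
= C(-s-1, j) (1 - x) ^ (l - s - j - 1)`. -/
theorem sum_antidiagonal_binom (l : ℤ) (s j n : ℕ) :
    ∑ p ∈ antidiagonal n, ((-1) ^ p.1 * binom l p.1) *
        (binom (-((s + p.2 : ℕ) : ℤ) - 1) j * ((s + p.2).choose s : ℂ))
      = binom (-(s : ℤ) - 1) j * ((-1) ^ n * binom (l - s - j - 1) n) := by
  rw [show l - s - j - 1 = l + (-(s : ℤ) - j - 1) by ring, binom_add, Finset.mul_sum,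
    Finset.mul_sum]
  refine Finset.sum_congr rfl fun p hp => ?_
  rw [binom_mul_choose, ← mem_antidiagonal.mp hp, pow_add]
  ring

/-- The counterpart of `sum_antidiagonal_binom` for powers of `z₁ - z₂` expanded in nonnegative
powers of `z₁` instead of `z₂`, whence the signs `(-1) ^ l` and `(-1) ^ (l - s - j - 1)`. -/
theorem sum_antidiagonal_binom' (l : ℤ) (s j n : ℕ) :
    ∑ p ∈ antidiagonal n, ((-1) ^ l * (-1) ^ p.1 * binom l p.1) *
        (((p.2 + j).choose j : ℂ) * binom (-((p.2 + j : ℕ) : ℤ) - 1) s)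
      = - (binom (-(s : ℤ) - 1) j *
        ((-1) ^ (l - s - j - 1) * (-1) ^ n * binom (l - s - j - 1) n)) := by
  have h : ∀ t : ℕ, ((t + j).choose j : ℂ) * binom (-((t + j : ℕ) : ℤ) - 1) s
      = (-1) ^ (s + j) * (binom (-((s + t : ℕ) : ℤ) - 1) j * ((s + t).choose s : ℂ)) := by
    intro t
    rw [binom_neg_succ, binom_neg_succ]
    have h1 := choose_mul_choose_add t j s
    have h2 : (s + (t + j)).choose (t + j) = (t + j + s).choose s := by
      rw [add_comm, Nat.choose_symm_add]
    have h3 : (s + t).choose s = (s + t).choose t := Nat.choose_symm_add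
    rw [h2] at h1
    rw [h3]
    have h5 : ((-1 : ℂ) ^ j) * (-1) ^ j = 1 := by rw [← mul_pow]; simp
    rw [pow_add]
    linear_combination (-1) ^ s * h1 - (-1) ^ s * ((s + t + j).choose j : ℂ) *
      ((s + t).choose t : ℂ) * h5
  have hl : ((-1 : ℂ) ^ l) * (-1) ^ (s + j) = - (-1) ^ (l - s - j - 1) := by
    have h0 : (-1 : ℂ) ≠ 0 := by norm_num
    rw [show l = (l - s - j - 1) + ((s + j : ℕ) : ℤ) + 1 by push_cast; ring, zpow_add₀ h0,
      zpow_add₀ h0, zpow_natCast, zpow_one]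
    have : ((-1 : ℂ) ^ (s + j)) * (-1) ^ (s + j) = 1 := by rw [← mul_pow]; simp
    rw [show l - s - j - 1 + ((s + j : ℕ) : ℤ) + 1 - s - j - 1 = l - s - j - 1 by push_cast; ring]
    linear_combination (-(-1 : ℂ) ^ (l - s - j - 1)) * this
  have := sum_antidiagonal_binom l s j n
  rw [show - (binom (-(s : ℤ) - 1) j *
        ((-1 : ℂ) ^ (l - s - j - 1) * (-1) ^ n * binom (l - s - j - 1) n)) =
      (-(-1) ^ (l - s - j - 1)) * (binom (-(s : ℤ) - 1) j *
        ((-1 : ℂ) ^ n * binom (l - s - j - 1) n)) by ring, ← hl, ← this, Finset.mul_sum]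
  refine Finset.sum_congr rfl fun p _ => ?_
  rw [h]
  ring

theorem sum_antidiagonal_choose_mul_binom (m x : ℤ) (j n : ℕ) :
    ∑ p ∈ antidiagonal n, binom m p.1 * (((p.2 + j).choose j : ℂ) * binom x (p.2 + j))
      = binom x j * binom (m + x - j) n := by
  rw [add_sub_assoc, binom_add, Finset.mul_sum]
  refine Finset.sum_congr rfl fun p _ => ?_
  rw [choose_mul_binom]
  ring

theorem sum_antidiagonal_choose_mul_choose (m : ℤ) (j k n : ℕ) :
    ∑ p ∈ antidiagonal n, binom m p.1 * (((k + j).choose j : ℂ) * (k.choose p.2 : ℂ))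
      = ((k + j).choose j : ℂ) * binom (m + k) n := by
  rw [binom_add, Finset.mul_sum]
  refine Finset.sum_congr rfl fun p _ => ?_
  rw [binom_natCast]
  ring

/-! ### Finitely supported sums over the natural numbers -/

section Finsum

variable {M N : Type*} [AddCommGroup M] [AddCommGroup N]

/-- A sequence is eventually zero if all its terms from some index on vanish. -/
def EvZero (f : ℕ → M) : Prop := ∃ B, ∀ i, B ≤ i → f i = 0

theorem EvZero.hasFiniteSupport {f : ℕ → M} (hf : EvZero f) : f.HasFiniteSupport := by
  obtain ⟨B, hB⟩ := hf
  refine (Set.finite_lt_nat B).subset fun i hi => ?_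
  by_contra h
  exact hi (hB i (not_lt.mp h))

theorem EvZero.add {f g : ℕ → M} (hf : EvZero f) (hg : EvZero g) :
    EvZero fun i => f i + g i := by
  obtain ⟨B, hB⟩ := hf
  obtain ⟨C, hC⟩ := hg
  exact ⟨max B C, fun i hi => by
    simp [hB i (le_of_max_le_left hi), hC i (le_of_max_le_right hi)]⟩

theorem EvZero.sub {f g : ℕ → M} (hf : EvZero f) (hg : EvZero g) :
    EvZero fun i => f i - g i := by
  obtain ⟨B, hB⟩ := hf
  obtain ⟨C, hC⟩ := hg
  exact ⟨max B C, fun i hi => by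
    simp [hB i (le_of_max_le_left hi), hC i (le_of_max_le_right hi)]⟩

theorem EvZero.mul_left {R : Type*} [Ring R] {f : ℕ → R} (hf : EvZero f) (g : ℕ → R) :
    EvZero fun i => g i * f i := by
  obtain ⟨B, hB⟩ := hf
  exact ⟨B, fun i hi => by simp [hB i hi]⟩

theorem mul_finsum_evZero {R : Type*} [Ring R] {f : ℕ → R} (hf : EvZero f) (a : R) :
    a * ∑ᶠ i, f i = ∑ᶠ i, a * f i :=
  mul_finsum' f a hf.hasFiniteSupport

theorem finsum_eq_sum_range {f : ℕ → M} {B : ℕ} (hB : ∀ i, B ≤ i → f i = 0) :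
    ∑ᶠ i, f i = ∑ i ∈ Finset.range B, f i := by
  refine finsum_eq_sum_of_support_subset _ fun i hi => ?_
  by_contra h
  exact hi (hB i (by simpa using h))

theorem finsum_eventually {f : ℕ → M} (hf : EvZero f) :
    ∀ᶠ B in atTop, ∑ᶠ i, f i = ∑ i ∈ Finset.range B, f i := by
  obtain ⟨B, hB⟩ := hf
  filter_upwards [eventually_ge_atTop B] with C hC
  exact finsum_eq_sum_range fun i hi => hB i (hC.trans hi)

theorem finsum_add_evZero {f g : ℕ → M} (hf : EvZero f) (hg : EvZero g) :
    ∑ᶠ i, (f i + g i) = ∑ᶠ i, f i + ∑ᶠ i, g i :=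
  finsum_add_distrib hf.hasFiniteSupport hg.hasFiniteSupport

theorem finsum_sub_evZero {f g : ℕ → M} (hf : EvZero f) (hg : EvZero g) :
    ∑ᶠ i, (f i - g i) = ∑ᶠ i, f i - ∑ᶠ i, g i :=
  finsum_sub_distrib hf.hasFiniteSupport hg.hasFiniteSupport

theorem evZero_sum {s : Finset ℕ} {f : ℕ → ℕ → M} (h : ∀ i ∈ s, EvZero (f i)) :
    EvZero fun k => ∑ i ∈ s, f i k := by
  choose! C hC using h
  exact ⟨s.sup C, fun k hk => Finset.sum_eq_zero fun i hi =>
    hC i hi k ((Finset.le_sup hi).trans hk)⟩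

/-- Finitely many sequences that are eventually zero have a common bound. -/
theorem exists_common_bound {f : ℕ → ℕ → M} (h : ∀ i, EvZero (f i)) (B : ℕ) :
    ∃ C, ∀ i < B, ∀ k, C ≤ k → f i k = 0 := by
  choose C hC using h
  refine ⟨(Finset.range B).sup C, fun i hi k hk => hC i k ?_⟩
  exact (Finset.le_sup (f := C) (Finset.mem_range.mpr hi)).trans hk

/-- A family with two indices has finite support if it is eventually zero in the first index,
uniformly in the second, and eventually zero in the second index for every value of the first. -/
theorem exists_square_bound {f : ℕ → ℕ → M} (h₁ : ∃ B, ∀ i k, B ≤ i → f i k = 0)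
    (h₂ : ∀ i, EvZero (f i)) : ∃ B, ∀ i k, (B ≤ i ∨ B ≤ k) → f i k = 0 := by
  obtain ⟨B, hB⟩ := h₁
  obtain ⟨C, hC⟩ := exists_common_bound h₂ B
  refine ⟨max B C, fun i k hik => ?_⟩
  by_cases hi : B ≤ i
  · exact hB i k hi
  · refine hC i (not_le.mp hi) k ?_
    rcases hik with h | h
    · exact absurd (le_of_max_le_left h) hi
    · exact le_of_max_le_right h

theorem evZero_finsum_right {f : ℕ → ℕ → M} (h₁ : ∃ B, ∀ i k, B ≤ i → f i k = 0)
    (h₂ : ∀ i, EvZero (f i)) : EvZero fun k => ∑ᶠ i, f i k := by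
  obtain ⟨B, hB⟩ := exists_square_bound h₁ h₂
  exact ⟨B, fun k hk => by simp [hB _ k (Or.inr hk)]⟩

theorem finsum_comm_evZero {f : ℕ → ℕ → M} (h₁ : ∃ B, ∀ i k, B ≤ i → f i k = 0)
    (h₂ : ∀ i, EvZero (f i)) : ∑ᶠ i, ∑ᶠ k, f i k = ∑ᶠ k, ∑ᶠ i, f i k := by
  obtain ⟨B, hB⟩ := exists_square_bound h₁ h₂
  have e1 : ∀ i, ∑ᶠ k, f i k = ∑ k ∈ Finset.range B, f i k := fun i =>
    finsum_eq_sum_range fun k hk => hB i k (Or.inr hk)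
  have e2 : ∀ k, ∑ᶠ i, f i k = ∑ i ∈ Finset.range B, f i k := fun k =>
    finsum_eq_sum_range fun i hi => hB i k (Or.inl hi)
  simp only [e1, e2]
  rw [finsum_eq_sum_range (B := B) fun i hi => by simp [hB i _ (Or.inl hi)],
    finsum_eq_sum_range (B := B) fun k hk => by simp [hB _ k (Or.inr hk)], Finset.sum_comm]

theorem finsum_antidiagonal {f : ℕ → ℕ → M} (h : ∃ B, ∀ i k, B ≤ i + k → f i k = 0) :
    ∑ᶠ i, ∑ᶠ k, f i k = ∑ᶠ n, ∑ p ∈ antidiagonal n, f p.1 p.2 := by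
  obtain ⟨B, hB⟩ := h
  have e1 : ∀ i, ∑ᶠ k, f i k = ∑ k ∈ Finset.range B, f i k := fun i =>
    finsum_eq_sum_range fun k hk => hB i k (by omega)
  simp only [e1]
  rw [finsum_eq_sum_range (B := B) fun i hi => Finset.sum_eq_zero fun k _ => hB i k (by omega),
    finsum_eq_sum_range (B := B) fun n hn => Finset.sum_eq_zero fun p hp => hB _ _ (by
      rw [mem_antidiagonal.mp hp]; exact hn),
    Finset.sum_sigma', Finset.sum_sigma']
  refine Finset.sum_bij_ne_zero (fun x _ _ => ⟨x.1 + x.2, (x.1, x.2)⟩) ?_ ?_ ?_ ?_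
  · rintro ⟨i, k⟩ _ h
    simp only [Finset.mem_sigma, Finset.mem_range, mem_antidiagonal, and_true]
    by_contra hc
    exact h (hB i k (by omega))
  · rintro ⟨i, k⟩ _ _ ⟨i', k'⟩ _ _ h
    have := congrArg (fun x : Σ _ : ℕ, ℕ × ℕ => x.2) h
    simp_all
  · rintro ⟨n, i, k⟩ hm hne
    simp only [Finset.mem_sigma, Finset.mem_range, mem_antidiagonal] at hm
    obtain ⟨hn, rfl⟩ := hm
    exact ⟨⟨i, k⟩, by simp; omega, hne, rfl⟩
  · rintro ⟨i, k⟩ _ _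
    rfl

theorem finsum_eq_finsum_add {f : ℕ → M} {s : ℕ} (h : ∀ r < s, f r = 0) (hf : EvZero f) :
    ∑ᶠ r, f r = ∑ᶠ t, f (t + s) := by
  obtain ⟨B, hB⟩ := hf
  rw [finsum_eq_sum_range (B := s + B) fun i hi => hB i (by omega),
    finsum_eq_sum_range (B := B) fun i hi => hB _ (by omega), Finset.sum_range_add,
    Finset.sum_eq_zero fun i hi => h i (Finset.mem_range.mp hi), zero_add]
  exact Finset.sum_congr rfl fun i _ => by rw [add_comm]

variable [Module ℂ M] [Module ℂ N]

theorem EvZero.map {f : ℕ → M} (hf : EvZero f) (g : ℕ → M →ₗ[ℂ] N) :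
    EvZero fun i => g i (f i) := by
  obtain ⟨B, hB⟩ := hf
  exact ⟨B, fun i hi => by simp [hB i hi]⟩

theorem EvZero.smul {f : ℕ → M} (hf : EvZero f) (c : ℕ → ℂ) : EvZero fun i => c i • f i := by
  obtain ⟨B, hB⟩ := hf
  exact ⟨B, fun i hi => by simp [hB i hi]⟩

theorem map_finsum_evZero {f : ℕ → M} (hf : EvZero f) (g : M →ₗ[ℂ] N) :
    g (∑ᶠ i, f i) = ∑ᶠ i, g (f i) :=
  map_finsum g hf.hasFiniteSupport

/-- A double sum whose terms factor through `i + k` becomes a single sum. -/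
theorem finsum_mul_antidiagonal (a b : ℕ → ℂ) {g : ℕ → M} (hg : EvZero g) :
    ∑ᶠ i, ∑ᶠ k, (a i * b k) • g (i + k)
      = ∑ᶠ n, (∑ p ∈ antidiagonal n, a p.1 * b p.2) • g n := by
  obtain ⟨B, hB⟩ := hg
  rw [finsum_antidiagonal ⟨B, fun i k h => by simp [hB _ h]⟩]
  refine finsum_congr fun n => ?_
  rw [Finset.sum_smul]
  exact Finset.sum_congr rfl fun p hp => by rw [mem_antidiagonal.mp hp]

end Finsum

/-! ### The induction step for the Jacobi identity -/

section JacobiStep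

variable {M₁ M₂ M₃ : Type*} [AddCommGroup M₁] [Module ℂ M₁]
  [AddCommGroup M₂] [Module ℂ M₂] [AddCommGroup M₃] [Module ℂ M₃]

/-- The coefficient of `z₀^{-l-1} z₁^{-m-1} z₂^{-n-1}` in the first term
`z₀⁻¹ δ((z₁-z₂)/z₀) Y(z₁) I(v,z₂) u` of the Jacobi identity, for one field `Y` on `M₃`. -/
noncomputable def jacobiLeft (Y : ℤ → Module.End ℂ M₃) (I : M₁ →ₗ[ℂ] ℂ → M₂ →ₗ[ℂ] M₃)
    (l m : ℤ) (n : ℂ) (v : M₁) (u : M₂) : M₃ :=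
  ∑ᶠ i : ℕ, ((-1) ^ i * binom l i) • Y (m + l - i) (I v (n + i) u)

/-- The coefficient of `z₀^{-l-1} z₁^{-m-1} z₂^{-n-1}` in the second term
`z₀⁻¹ δ((z₂-z₁)/(-z₀)) I(v,z₂) Y(z₁) u` of the Jacobi identity, for one field `Y` on `M₂`. -/
noncomputable def jacobiRight (Y : ℤ → Module.End ℂ M₂) (I : M₁ →ₗ[ℂ] ℂ → M₂ →ₗ[ℂ] M₃)
    (l m : ℤ) (n : ℂ) (v : M₁) (u : M₂) : M₃ :=
  ∑ᶠ i : ℕ, ((-1) ^ l * (-1) ^ i * binom l i) • I v (n + l - i) (Y (m + i) u)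

/-- The coefficient of `z₀^{-l-1} z₁^{-m-1} z₂^{-n-1}` in the third term
`z₂⁻¹ δ((z₁-z₀)/z₂) I(Y(z₀)v,z₂) u` of the Jacobi identity, for one field `Y` on `M₁`. -/
noncomputable def jacobiIterate (Y : ℤ → Module.End ℂ M₁) (I : M₁ →ₗ[ℂ] ℂ → M₂ →ₗ[ℂ] M₃)
    (l m : ℤ) (n : ℂ) (v : M₁) (u : M₂) : M₃ :=
  ∑ᶠ i : ℕ, binom m i • I (Y (l + i) v) (m + n - i) u

/-- A field is truncated from below if each vector is killed by all modes of large index. -/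
def Truncated {M : Type*} [AddCommGroup M] [Module ℂ M] (Y : ℤ → Module.End ℂ M) : Prop :=
  ∀ (w : M) (m : ℤ), EvZero fun k : ℕ => Y (m + k) w

/-- The operator-valued analogue of `Truncated`, with complex indices. -/
def TruncatedOp (I : M₁ →ₗ[ℂ] ℂ → M₂ →ₗ[ℂ] M₃) : Prop :=
  ∀ (v : M₁) (u : M₂) (n : ℂ), EvZero fun k : ℕ => I v (n + k) u

/-- `Z(z) = :∂^{(j)}h(z) Y(z):`, in modes, where `h(z) = ∑ H_r z^{-r-1}`. -/
def IsNormalProduct {M : Type*} [AddCommGroup M] [Module ℂ M] (H : ℤ → Module.End ℂ M) (j : ℕ)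
    (Y Z : ℤ → Module.End ℂ M) : Prop :=
  ∀ (p : ℤ) (w : M), Z p w =
    ∑ᶠ k : ℕ, ((k + j).choose j : ℂ) • H (-((k + j : ℕ) : ℤ) - 1) (Y (p + k) w)
    + ∑ᶠ r : ℕ, binom (-(r : ℤ) - 1) j • Y (p - r - j - 1) (H r w)

/-- `I(h(-k-1)v, z) = :∂^{(k)}h(z) I(v, z):`, in modes. -/
def IsCreative (H₁ : ℤ → Module.End ℂ M₁) (H₂ : ℤ → Module.End ℂ M₂) (H₃ : ℤ → Module.End ℂ M₃)
    (I : M₁ →ₗ[ℂ] ℂ → M₂ →ₗ[ℂ] M₃) : Prop :=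
  ∀ (k : ℕ) (v : M₁) (q : ℂ) (u : M₂), I (H₁ (-(k : ℤ) - 1) v) q u =
    ∑ᶠ t : ℕ, ((t + k).choose k : ℂ) • H₃ (-((t + k : ℕ) : ℤ) - 1) (I v (q + t) u)
    + ∑ᶠ r : ℕ, binom (-(r : ℤ) - 1) k • I v (q - r - k - 1) (H₂ r u)

/-- `[h(m), I(v, z)] = ∑ₛ C(m, s) z^{m-s} I(h(s)v, z)`, in modes. -/
def HasCommutatorFormula (H₁ : ℤ → Module.End ℂ M₁) (H₂ : ℤ → Module.End ℂ M₂)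
    (H₃ : ℤ → Module.End ℂ M₃) (I : M₁ →ₗ[ℂ] ℂ → M₂ →ₗ[ℂ] M₃) : Prop :=
  ∀ (m : ℤ) (v : M₁) (q : ℂ) (u : M₂), H₃ m (I v q u) = I v q (H₂ m u)
    + ∑ᶠ s : ℕ, binom m s • I (H₁ s v) (q + m - s) u

theorem Truncated.nat {M : Type*} [AddCommGroup M] [Module ℂ M] {H : ℤ → Module.End ℂ M}
    (hH : Truncated H) (w : M) : EvZero fun r : ℕ => H r w := by
  simpa using hH w 0

variable {I : M₁ →ₗ[ℂ] ℂ → M₂ →ₗ[ℂ] M₃} {Y₁ Z₁ H₁ : ℤ → Module.End ℂ M₁}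
  {Y₂ Z₂ H₂ : ℤ → Module.End ℂ M₂} {Y₃ Z₃ H₃ : ℤ → Module.End ℂ M₃}

theorem evZero_left (hI : TruncatedOp I) (l m : ℤ) (n : ℂ) (v : M₁) (u : M₂) :
    EvZero fun i : ℕ => ((-1) ^ i * binom l i) • Y₃ (m + l - i) (I v (n + i) u) :=
  ((hI v u n).map fun i => Y₃ (m + l - i)).smul _

theorem evZero_right (hY₂ : Truncated Y₂) (l m : ℤ) (n : ℂ) (v : M₁) (u : M₂) :
    EvZero fun i : ℕ => ((-1) ^ l * (-1) ^ i * binom l i) • I v (n + l - i) (Y₂ (m + i) u) :=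
  ((hY₂ u m).map fun i => I v (n + l - i)).smul _

theorem evZero_iterate (hY₁ : Truncated Y₁) (l m : ℤ) (n : ℂ) (v : M₁) (u : M₂) :
    EvZero fun i : ℕ => binom m i • I (Y₁ (l + i) v) (m + n - i) u :=
  ((hY₁ v l).map fun i => LinearMap.applyₗ u ∘ₗ LinearMap.proj (m + n - i : ℂ) ∘ₗ I).smul _

theorem evZero_jacobiLeft (hI : TruncatedOp I) (hY₃ : Truncated Y₃)
    (l m : ℤ) (n : ℂ) (v : M₁) (u : M₂) :
    EvZero fun k : ℕ => jacobiLeft Y₃ I l (m + k) n v u := by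
  obtain ⟨B, hB⟩ := hI v u n
  refine evZero_finsum_right (f := fun i k : ℕ =>
    ((-1) ^ i * binom l i) • Y₃ (m + k + l - i) (I v (n + i) u))
    ⟨B, fun i k hi => by simp [hB i hi]⟩ fun i => ?_
  have := (hY₃ (I v (n + i) u) (m + l - i)).smul fun _ => ((-1) ^ i * binom l i)
  convert this using 5
  ring

theorem evZero_jacobiRight (hY₂ : Truncated Y₂)
    (l m : ℤ) (n : ℂ) (v : M₁) (u : M₂) :
    EvZero fun k : ℕ => jacobiRight Y₂ I l (m + k) n v u := by
  obtain ⟨B, hB⟩ := hY₂ u m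
  refine ⟨B, fun k hk => ?_⟩
  simp only [jacobiRight]
  rw [finsum_eq_zero_of_forall_eq_zero]
  intro i
  have : Y₂ (m + k + i) u = 0 := by
    have := hB (k + i) (by omega)
    rwa [show m + k + i = m + ((k + i : ℕ) : ℤ) by push_cast; ring]
  simp [this]

/-- The common recursion satisfied by the three terms of the Jacobi identity when the field `Y` is
replaced by `:∂^{(j)}h(z) Y(z):`. -/
noncomputable def stepTerm (J : ℤ → ℤ → M₁ → M₂ → M₃) (H₁ : ℤ → Module.End ℂ M₁)
    (H₂ : ℤ → Module.End ℂ M₂) (H₃ : ℤ → Module.End ℂ M₃) (j : ℕ) (l m : ℤ) (v : M₁) (u : M₂) :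
    M₃ :=
  ∑ᶠ k : ℕ, ((k + j).choose j : ℂ) • H₃ (-((k + j : ℕ) : ℤ) - 1) (J l (m + k) v u)
    + ∑ᶠ r : ℕ, binom (-(r : ℤ) - 1) j • J l (m - r - j - 1) v (H₂ r u)
    + ∑ᶠ s : ℕ, binom (-(s : ℤ) - 1) j • J (l - s - j - 1) m (H₁ s v) u

/-- In the first term, the annihilation operators of `:∂^{(j)}h(z₁) Y(z₁):` are moved to the right
past `I(v, z₂)`. -/
theorem jacobiLeft_step (hI : TruncatedOp I) (hY₃ : Truncated Y₃)
    (hH₁ : Truncated H₁) (hH₂ : Truncated H₂) {j : ℕ}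
    (hZ : IsNormalProduct H₃ j Y₃ Z₃) (hP : HasCommutatorFormula H₁ H₂ H₃ I)
    (l m : ℤ) (n : ℂ) (v : M₁) (u : M₂) :
    jacobiLeft Z₃ I l m n v u
      = stepTerm (fun l m v u => jacobiLeft Y₃ I l m n v u) H₁ H₂ H₃ j l m v u := by
  obtain ⟨B, hB⟩ := hI v u n
  obtain ⟨S, hS⟩ := hH₁.nat v
  obtain ⟨R, hR⟩ := hH₂.nat u
  -- creation operators already stand on the left
  have h1 : ∑ᶠ i : ℕ, ((-1) ^ i * binom l i) • ∑ᶠ k : ℕ, ((k + j).choose j : ℂ) •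
        H₃ (-((k + j : ℕ) : ℤ) - 1) (Y₃ (m + l - i + k) (I v (n + i) u))
      = ∑ᶠ k : ℕ, ((k + j).choose j : ℂ) •
        H₃ (-((k + j : ℕ) : ℤ) - 1) (jacobiLeft Y₃ I l (m + k) n v u) := by
    simp only [smul_finsum]
    rw [finsum_comm_evZero ⟨B, fun i k hi => by simp [hB i hi]⟩]
    · refine finsum_congr fun k => ?_
      rw [jacobiLeft, map_finsum_evZero (evZero_left hI ..), smul_finsum]
      refine finsum_congr fun i => ?_
      rw [map_smul, smul_comm, show m + l - i + k = m + k + l - i by ring]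
    · exact fun i => (((hY₃ _ _).map fun k : ℕ => H₃ (-((k + j : ℕ) : ℤ) - 1)).smul _).smul _
  -- annihilation operators, after they have been moved past `I` to act on `u`
  have h2 : ∑ᶠ i : ℕ, ((-1) ^ i * binom l i) • ∑ᶠ r : ℕ, binom (-(r : ℤ) - 1) j •
        Y₃ (m + l - i - r - j - 1) (I v (n + i) (H₂ r u))
      = ∑ᶠ r : ℕ, binom (-(r : ℤ) - 1) j • jacobiLeft Y₃ I l (m - r - j - 1) n v (H₂ r u) := by
    simp only [smul_finsum]
    rw [← finsum_comm_evZero (f := fun r i : ℕ => ((-1) ^ i * binom l i) •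
      binom (-(r : ℤ) - 1) j • Y₃ (m + l - i - r - j - 1) (I v (n + i) (H₂ r u)))
      ⟨R, fun r i hr => by simp [hR r hr]⟩]
    · refine finsum_congr fun r => ?_
      rw [jacobiLeft, smul_finsum]
      refine finsum_congr fun i => ?_
      rw [smul_comm, show m + l - i - r - j - 1 = m - r - j - 1 + l - i by ring]
    · exact fun r => (((hI v (H₂ r u) n).map
        fun i : ℕ => Y₃ (m + l - i - r - j - 1)).smul _).smul _
  -- the commutators: the terms with `h(s)v` add up to a power of `z₁ - z₂` with a smaller exponent
  have h3 : ∀ s : ℕ, ∑ᶠ i : ℕ, ∑ᶠ r : ℕ, ((-1) ^ i * binom l i * (binom (-(r : ℤ) - 1) j *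
        (r.choose s : ℂ))) • Y₃ (m + l - i - r - j - 1) (I (H₁ s v) (n + i + r - s) u)
      = binom (-(s : ℤ) - 1) j • jacobiLeft Y₃ I (l - s - j - 1) m n (H₁ s v) u := by
    intro s
    have e : ∀ i : ℕ, ∑ᶠ r : ℕ, ((-1) ^ i * binom l i * (binom (-(r : ℤ) - 1) j *
        (r.choose s : ℂ))) • Y₃ (m + l - i - r - j - 1) (I (H₁ s v) (n + i + r - s) u)
        = ∑ᶠ t : ℕ, ((-1) ^ i * binom l i * (binom (-((s + t : ℕ) : ℤ) - 1) j *
        ((s + t).choose s : ℂ))) • Y₃ (m + (l - s - j - 1) - ((i + t : ℕ) : ℤ))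
          (I (H₁ s v) (n + ((i + t : ℕ) : ℂ)) u) := by
      intro i
      rw [finsum_eq_finsum_add (s := s)]
      · refine finsum_congr fun t => ?_
        rw [add_comm t s]
        congr 3
        · push_cast; ring
        · push_cast; ring_nf
      · intro r hr
        simp [Nat.choose_eq_zero_of_lt hr]
      · refine EvZero.smul (EvZero.map (f := fun r : ℕ => I (H₁ s v) (n + i + r - s) u) ?_
          fun r : ℕ => Y₃ (m + l - i - r - j - 1)) _
        have := hI (H₁ s v) u (n + i - s)
        convert this using 4
        ring
    simp only [e]
    rw [finsum_mul_antidiagonal (fun i => (-1) ^ i * binom l i)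
      (fun t => binom (-((s + t : ℕ) : ℤ) - 1) j * ((s + t).choose s : ℂ))
      (g := fun i => Y₃ (m + (l - s - j - 1) - i) (I (H₁ s v) (n + i) u))
      ((hI _ _ _).map fun i : ℕ => Y₃ (m + (l - s - j - 1) - i)), jacobiLeft, smul_finsum]
    refine finsum_congr fun i => ?_
    rw [sum_antidiagonal_binom, smul_smul]
  have hIs : ∀ (s i : ℕ), EvZero fun r : ℕ => I (H₁ s v) (n + i + r - s) u := by
    intro s i
    have := hI (H₁ s v) u (n + i - s)
    convert this using 4
    ring
  have key : ∀ i : ℕ, Z₃ (m + l - i) (I v (n + i) u)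
      = ∑ᶠ k : ℕ, ((k + j).choose j : ℂ) •
          H₃ (-((k + j : ℕ) : ℤ) - 1) (Y₃ (m + l - i + k) (I v (n + i) u))
        + ∑ᶠ r : ℕ, binom (-(r : ℤ) - 1) j • Y₃ (m + l - i - r - j - 1) (I v (n + i) (H₂ r u))
        + ∑ s ∈ Finset.range S, ∑ᶠ r : ℕ, (binom (-(r : ℤ) - 1) j * (r.choose s : ℂ)) •
          Y₃ (m + l - i - r - j - 1) (I (H₁ s v) (n + i + r - s) u) := by
    intro i
    rw [hZ, add_assoc]
    congr 1
    rw [← finsum_sum_comm _ _ fun s _ => EvZero.hasFiniteSupport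
      (((hIs s i).map fun r : ℕ => Y₃ (m + l - i - r - j - 1)).smul _),
      ← finsum_add_evZero]
    · refine finsum_congr fun r => ?_
      rw [hP, finsum_eq_sum_range (B := S) fun s hs => by simp [hS s hs], map_add, smul_add,
        map_sum, Finset.smul_sum]
      congr 1
      refine Finset.sum_congr rfl fun s _ => ?_
      rw [map_smul, smul_smul, Int.cast_natCast, binom_natCast]
    · exact ⟨R, fun r hr => by simp [hR r hr]⟩
    · have : ∀ s, EvZero fun r : ℕ => (binom (-(r : ℤ) - 1) j * (r.choose s : ℂ)) •
          Y₃ (m + l - i - r - j - 1) (I (H₁ s v) (n + i + r - s) u) := fun s =>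
        (((hIs s i).map fun r : ℕ => Y₃ (m + l - i - r - j - 1)).smul _)
      obtain ⟨C, hC⟩ := exists_common_bound this S
      exact ⟨C, fun r hr => Finset.sum_eq_zero fun s hs =>
        hC s (Finset.mem_range.mp hs) r hr⟩
  have E1 : EvZero fun i : ℕ => ((-1) ^ i * binom l i) • ∑ᶠ k : ℕ, ((k + j).choose j : ℂ) •
      H₃ (-((k + j : ℕ) : ℤ) - 1) (Y₃ (m + l - i + k) (I v (n + i) u)) :=
    ⟨B, fun i hi => by simp [hB i hi]⟩
  have E2 : EvZero fun i : ℕ => ((-1) ^ i * binom l i) • ∑ᶠ r : ℕ, binom (-(r : ℤ) - 1) j •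
      Y₃ (m + l - i - r - j - 1) (I v (n + i) (H₂ r u)) := by
    obtain ⟨C, hC⟩ := exists_common_bound (fun r : ℕ => hI v (H₂ r u) n) R
    refine ⟨C, fun i hi => ?_⟩
    beta_reduce
    rw [finsum_eq_zero_of_forall_eq_zero, smul_zero]
    intro r
    by_cases hr : R ≤ r
    · simp [hR r hr]
    · simp [hC r (not_le.mp hr) i hi]
  have E3 : ∀ s : ℕ, EvZero fun i : ℕ => ∑ᶠ r : ℕ, ((-1) ^ i * binom l i *
      (binom (-(r : ℤ) - 1) j * (r.choose s : ℂ))) •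
        Y₃ (m + l - i - r - j - 1) (I (H₁ s v) (n + i + r - s) u) := by
    intro s
    obtain ⟨C, hC⟩ := hI (H₁ s v) u n
    refine ⟨C, fun i hi => finsum_eq_zero_of_forall_eq_zero fun r => ?_⟩
    by_cases hr : r < s
    · simp [Nat.choose_eq_zero_of_lt hr]
    · have : I (H₁ s v) (n + ((i + r - s : ℕ) : ℂ)) u = 0 := hC (i + r - s) (by omega)
      rw [Nat.cast_sub (by omega), Nat.cast_add, ← add_sub_assoc, ← add_assoc] at this
      simp [this]
  rw [jacobiLeft, stepTerm, ← h1, ← h2, ← finsum_add_evZero E1 E2, finsum_eq_sum_range (B := S)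
    (f := fun s : ℕ => binom (-(s : ℤ) - 1) j • jacobiLeft Y₃ I (l - s - j - 1) m n (H₁ s v) u)
    fun s hs => by simp [jacobiLeft, hS s hs], Finset.sum_congr rfl fun s _ => (h3 s).symm,
    ← finsum_sum_comm _ _ fun s _ => (E3 s).hasFiniteSupport,
    ← finsum_add_evZero (E1.add E2) (evZero_sum fun s _ => E3 s)]
  refine finsum_congr fun i => ?_
  rw [key, smul_add, smul_add, Finset.smul_sum]
  congr 1
  refine Finset.sum_congr rfl fun s _ => ?_
  rw [smul_finsum]
  refine finsum_congr fun r => ?_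
  rw [smul_smul]

/-- In the second term, the creation operators of `:∂^{(j)}h(z₁) Y(z₁):` are moved to the left past
`I(v, z₂)`. -/
theorem jacobiRight_step (hY₂ : Truncated Y₂)
    (hH₁ : Truncated H₁) (hH₂ : Truncated H₂) {j : ℕ}
    (hZ : IsNormalProduct H₂ j Y₂ Z₂) (hP : HasCommutatorFormula H₁ H₂ H₃ I)
    (l m : ℤ) (n : ℂ) (v : M₁) (u : M₂) :
    jacobiRight Z₂ I l m n v u
      = stepTerm (fun l m v u => jacobiRight Y₂ I l m n v u) H₁ H₂ H₃ j l m v u := by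
  obtain ⟨B, hB⟩ := hY₂ u m
  obtain ⟨S, hS⟩ := hH₁.nat v
  obtain ⟨R, hR⟩ := hH₂.nat u
  have hY : ∀ i k : ℕ, B ≤ i + k → Y₂ (m + ((i + k : ℕ) : ℤ)) u = 0 := fun i k h => hB (i + k) h
  have hY0 : ∀ i k : ℕ, B ≤ i + k → Y₂ (m + i + k) u = 0 := fun i k h => by
    have := hY i k h
    rwa [Nat.cast_add, ← add_assoc] at this
  set c : ℕ → ℂ := fun i => (-1) ^ l * (-1) ^ i * binom l i with hc
  have h1 : ∑ᶠ i : ℕ, c i • ∑ᶠ k : ℕ, ((k + j).choose j : ℂ) •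
        H₃ (-((k + j : ℕ) : ℤ) - 1) (I v (n + l - i) (Y₂ (m + i + k) u))
      = ∑ᶠ k : ℕ, ((k + j).choose j : ℂ) •
        H₃ (-((k + j : ℕ) : ℤ) - 1) (jacobiRight Y₂ I l (m + k) n v u) := by
    simp only [smul_finsum]
    rw [finsum_comm_evZero ⟨B, fun i k hi => by simp [hY0 i k (by omega)]⟩]
    · refine finsum_congr fun k => ?_
      rw [jacobiRight, map_finsum_evZero (evZero_right hY₂ ..), smul_finsum]
      refine finsum_congr fun i => ?_
      rw [map_smul, smul_comm, add_right_comm]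
    · exact fun i => ⟨B, fun k hk => by simp [hY0 i k (by omega)]⟩
  have h2 : ∑ᶠ i : ℕ, c i • ∑ᶠ r : ℕ, binom (-(r : ℤ) - 1) j •
        I v (n + l - i) (Y₂ (m + i - r - j - 1) (H₂ r u))
      = ∑ᶠ r : ℕ, binom (-(r : ℤ) - 1) j • jacobiRight Y₂ I l (m - r - j - 1) n v (H₂ r u) := by
    simp only [smul_finsum]
    rw [← finsum_comm_evZero (f := fun r i : ℕ => c i •
      binom (-(r : ℤ) - 1) j • I v (n + l - i) (Y₂ (m + i - r - j - 1) (H₂ r u)))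
      ⟨R, fun r i hr => by simp [hR r hr]⟩]
    · refine finsum_congr fun r => ?_
      rw [jacobiRight, smul_finsum]
      refine finsum_congr fun i => ?_
      rw [smul_comm, show m + i - r - j - 1 = m - r - j - 1 + i by ring]
    · intro r
      refine EvZero.smul (EvZero.smul (EvZero.map
        (f := fun i : ℕ => Y₂ (m + i - r - j - 1) (H₂ r u)) ?_ fun i : ℕ => I v (n + l - i)) _) _
      have := hY₂ (H₂ r u) (m - r - j - 1)
      convert this using 4
      ring
  -- the commutators of creation operators with `I`, expanded in the domain opposite to that of the
  -- first term
  have h3 : ∀ s : ℕ, ∑ᶠ i : ℕ, ∑ᶠ k : ℕ, (c i * (((k + j).choose j : ℂ) *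
        binom (-((k + j : ℕ) : ℤ) - 1) s)) •
          I (H₁ s v) (n + l - s - j - 1 - ((i + k : ℕ) : ℂ)) (Y₂ (m + ((i + k : ℕ) : ℤ)) u)
      = - (binom (-(s : ℤ) - 1) j • jacobiRight Y₂ I (l - s - j - 1) m n (H₁ s v) u) := by
    intro s
    rw [finsum_mul_antidiagonal c
      (fun k => ((k + j).choose j : ℂ) * binom (-((k + j : ℕ) : ℤ) - 1) s)
      (g := fun i => I (H₁ s v) (n + l - s - j - 1 - i) (Y₂ (m + i) u))
      ((hY₂ _ _).map fun i : ℕ => I (H₁ s v) (n + l - s - j - 1 - i)), jacobiRight,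
      smul_finsum, ← finsum_neg_distrib]
    refine finsum_congr fun i => ?_
    rw [sum_antidiagonal_binom', neg_smul, smul_smul]
    push_cast
    simp only [add_sub_assoc]
  have key : ∀ i : ℕ, I v (n + l - i) (Z₂ (m + i) u)
      = ∑ᶠ k : ℕ, ((k + j).choose j : ℂ) •
          H₃ (-((k + j : ℕ) : ℤ) - 1) (I v (n + l - i) (Y₂ (m + i + k) u))
        + ∑ᶠ r : ℕ, binom (-(r : ℤ) - 1) j • I v (n + l - i) (Y₂ (m + i - r - j - 1) (H₂ r u))
        - ∑ s ∈ Finset.range S, ∑ᶠ k : ℕ, (((k + j).choose j : ℂ) *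
            binom (-((k + j : ℕ) : ℤ) - 1) s) •
          I (H₁ s v) (n + l - s - j - 1 - ((i + k : ℕ) : ℂ)) (Y₂ (m + ((i + k : ℕ) : ℤ)) u) := by
    intro i
    have E0 : ∀ s : ℕ, EvZero fun k : ℕ => (((k + j).choose j : ℂ) *
        binom (-((k + j : ℕ) : ℤ) - 1) s) •
          I (H₁ s v) (n + l - s - j - 1 - ((i + k : ℕ) : ℂ)) (Y₂ (m + ((i + k : ℕ) : ℤ)) u) :=
      fun s => ⟨B, fun k hk => by simp only [hY i k (by omega), map_zero, smul_zero]⟩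
    rw [hZ, map_add, add_sub_right_comm (a := finsum _), map_finsum_evZero, map_finsum_evZero]
    · congr 1
      · rw [← finsum_sum_comm _ _ fun s _ => (E0 s).hasFiniteSupport, ← finsum_sub_evZero]
        · refine finsum_congr fun k => ?_
          rw [hP, finsum_eq_sum_range (B := S) fun s hs => by simp [hS s hs], smul_add,
            map_smul, Finset.smul_sum, eq_sub_iff_add_eq]
          congr 1
          refine Finset.sum_congr rfl fun s _ => ?_
          rw [smul_smul, show m + ((i + k : ℕ) : ℤ) = m + i + k by push_cast; ring]
          congr 3
          push_cast
          ring_nf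
        · exact ⟨B, fun k hk => by simp [hY0 i k (by omega)]⟩
        · exact evZero_sum fun s _ => E0 s
      · exact finsum_congr fun r => map_smul ..
    · exact ⟨R, fun r hr => by simp [hR r hr]⟩
    · exact ⟨B, fun k hk => by simp [hY0 i k (by omega)]⟩
  have E1 : EvZero fun i : ℕ => c i • ∑ᶠ k : ℕ, ((k + j).choose j : ℂ) •
      H₃ (-((k + j : ℕ) : ℤ) - 1) (I v (n + l - i) (Y₂ (m + i + k) u)) :=
    ⟨B, fun i hi => by simp [hY0 i _ (hi.trans (Nat.le_add_right _ _))]⟩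
  have E2 : EvZero fun i : ℕ => c i • ∑ᶠ r : ℕ, binom (-(r : ℤ) - 1) j •
      I v (n + l - i) (Y₂ (m + i - r - j - 1) (H₂ r u)) := by
    obtain ⟨C, hC⟩ := exists_common_bound (fun r : ℕ => hY₂ (H₂ r u) (m - r - j - 1)) R
    refine ⟨C, fun i hi => ?_⟩
    beta_reduce
    rw [finsum_eq_zero_of_forall_eq_zero, smul_zero]
    intro r
    by_cases hr : R ≤ r
    · simp [hR r hr]
    · rw [show m + i - r - j - 1 = m - r - j - 1 + i by ring, hC r (not_le.mp hr) i hi, map_zero,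
        smul_zero]
  have E3 : ∀ s : ℕ, EvZero fun i : ℕ => ∑ᶠ k : ℕ, (c i * (((k + j).choose j : ℂ) *
        binom (-((k + j : ℕ) : ℤ) - 1) s)) •
          I (H₁ s v) (n + l - s - j - 1 - ((i + k : ℕ) : ℂ)) (Y₂ (m + ((i + k : ℕ) : ℤ)) u) :=
    fun s => ⟨B, fun i hi => finsum_eq_zero_of_forall_eq_zero fun k => by
      rw [hY i k (by omega), map_zero, smul_zero]⟩
  rw [jacobiRight, stepTerm, ← h1, ← h2, ← finsum_add_evZero E1 E2, finsum_eq_sum_range (B := S)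
    (f := fun s : ℕ => binom (-(s : ℤ) - 1) j • jacobiRight Y₂ I (l - s - j - 1) m n (H₁ s v) u)
    fun s hs => by simp [jacobiRight, hS s hs],
    Finset.sum_congr rfl fun s _ => neg_eq_iff_eq_neg.mp (h3 s).symm,
    Finset.sum_neg_distrib, ← sub_eq_add_neg,
    ← finsum_sum_comm _ _ fun s _ => (E3 s).hasFiniteSupport,
    ← finsum_sub_evZero (E1.add E2) (evZero_sum fun s _ => E3 s)]
  refine finsum_congr fun i => ?_
  rw [key, smul_sub, smul_add, Finset.smul_sum]
  congr 1
  refine Finset.sum_congr rfl fun s _ => ?_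
  rw [smul_finsum]
  refine finsum_congr fun r => ?_
  rw [smul_smul]

/-- In the third term, `I(h(-k-j-1) Y(z₀)v, z₂)` is expanded by the normal ordering rule for `I`. -/
theorem jacobiIterate_step (hI : TruncatedOp I) (hY₁ : Truncated Y₁)
    (hH₁ : Truncated H₁) (hH₂ : Truncated H₂) {j : ℕ}
    (hZ : IsNormalProduct H₁ j Y₁ Z₁) (hC : IsCreative H₁ H₂ H₃ I)
    (l m : ℤ) (n : ℂ) (v : M₁) (u : M₂) :
    jacobiIterate Z₁ I l m n v u
      = stepTerm (fun l m v u => jacobiIterate Y₁ I l m n v u) H₁ H₂ H₃ j l m v u := by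
  obtain ⟨B, hB⟩ := hY₁ v l
  obtain ⟨S, hS⟩ := hH₁.nat v
  obtain ⟨R, hR⟩ := hH₂.nat u
  have hY : ∀ i k : ℕ, B ≤ i + k → Y₁ (l + ((i + k : ℕ) : ℤ)) v = 0 := fun i k h => hB (i + k) h
  -- the coefficients in which creation operators act on the value of `I`
  set W : ℕ → ℕ → M₃ := fun i k =>
    H₃ (-((k + j : ℕ) : ℤ) - 1) (I (Y₁ (l + i) v) (m + n - i + k) u) with hW
  have hW0 : ∀ i k, B ≤ i → W i k = 0 := fun i k h => by simp [hW, hB i h]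
  have hWk : ∀ i, EvZero fun k => W i k := fun i =>
    (hI (Y₁ (l + i) v) u (m + n - i)).map fun k => H₃ (-((k + j : ℕ) : ℤ) - 1)
  have h1 : ∑ᶠ i : ℕ, binom m i • ∑ᶠ k : ℕ, ∑ᶠ t : ℕ,
        (((t + j).choose j : ℂ) * (t.choose k : ℂ)) • W (i + k) t
      = ∑ᶠ k : ℕ, ((k + j).choose j : ℂ) •
        H₃ (-((k + j : ℕ) : ℤ) - 1) (jacobiIterate Y₁ I l (m + k) n v u) := by
    simp only [smul_finsum, smul_smul]
    rw [finsum_antidiagonal (f := fun i k => ∑ᶠ t : ℕ,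
      (binom m i * (((t + j).choose j : ℂ) * (t.choose k : ℂ))) • W (i + k) t)
      ⟨B, fun i k h => by simp [hW0 _ _ h]⟩]
    have e : ∀ i : ℕ, ∑ p ∈ antidiagonal i, ∑ᶠ t : ℕ, (binom m p.1 *
        (((t + j).choose j : ℂ) * (t.choose p.2 : ℂ))) • W (p.1 + p.2) t
        = ∑ᶠ t : ℕ, (((t + j).choose j : ℂ) * binom (m + t) i) • W i t := by
      intro i
      rw [← finsum_sum_comm _ _ fun p _ => EvZero.hasFiniteSupport ((hWk _).smul _)]
      refine finsum_congr fun t => ?_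
      rw [← sum_antidiagonal_choose_mul_choose, Finset.sum_smul]
      exact Finset.sum_congr rfl fun p hp => by rw [mem_antidiagonal.mp hp]
    simp only [e]
    rw [finsum_comm_evZero ⟨B, fun i k hi => by simp [hW0 i k hi]⟩ fun i => (hWk i).smul _]
    refine finsum_congr fun k => ?_
    rw [jacobiIterate, map_finsum_evZero (evZero_iterate hY₁ ..), smul_finsum]
    refine finsum_congr fun i => ?_
    rw [map_smul, smul_smul, hW]
    beta_reduce
    congr 4
    push_cast
    ring_nf
  have h2 : ∀ r : ℕ, ∑ᶠ i : ℕ, ∑ᶠ k : ℕ, (binom m i * (((k + j).choose j : ℂ) *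
        binom (-(r : ℤ) - 1) (k + j))) •
          I (Y₁ (l + ((i + k : ℕ) : ℤ)) v) (m + n - r - j - 1 - ((i + k : ℕ) : ℂ)) (H₂ r u)
      = binom (-(r : ℤ) - 1) j • jacobiIterate Y₁ I l (m - r - j - 1) n v (H₂ r u) := by
    intro r
    rw [finsum_mul_antidiagonal (binom m)
      (fun k => ((k + j).choose j : ℂ) * binom (-(r : ℤ) - 1) (k + j))
      (g := fun i => I (Y₁ (l + i) v) (m + n - r - j - 1 - i) (H₂ r u))
      ⟨B, fun i hi => by simp [hB i hi]⟩, jacobiIterate, smul_finsum]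
    refine finsum_congr fun i => ?_
    rw [sum_antidiagonal_choose_mul_binom, smul_smul]
    congr 3
    · ring_nf
    · push_cast
      ring_nf
  have h3 : ∑ᶠ i : ℕ, binom m i • ∑ᶠ s : ℕ, binom (-(s : ℤ) - 1) j •
        I (Y₁ (l + i - s - j - 1) (H₁ s v)) (m + n - i) u
      = ∑ᶠ s : ℕ, binom (-(s : ℤ) - 1) j •
        jacobiIterate Y₁ I (l - s - j - 1) m n (H₁ s v) u := by
    simp only [smul_finsum]
    rw [← finsum_comm_evZero (f := fun s i : ℕ => binom m i • binom (-(s : ℤ) - 1) j •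
        I (Y₁ (l + i - s - j - 1) (H₁ s v)) (m + n - i) u)
      ⟨S, fun s i hs => by simp [hS s hs]⟩]
    · refine finsum_congr fun s => ?_
      rw [jacobiIterate, smul_finsum]
      refine finsum_congr fun i => ?_
      rw [smul_comm, show l + i - s - j - 1 = l - s - j - 1 + i by ring]
    · intro s
      obtain ⟨C, hC⟩ := hY₁ (H₁ s v) (l - s - j - 1)
      refine ⟨C, fun i hi => ?_⟩
      have : Y₁ (l - s - j - 1 + i) (H₁ s v) = 0 := hC i hi
      rw [← show l + i - s - j - 1 = l - s - j - 1 + i by ring] at this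
      simp [this]
  have key : ∀ i : ℕ, I (Z₁ (l + i) v) (m + n - i) u
      = ∑ᶠ k : ℕ, ∑ᶠ t : ℕ, (((t + j).choose j : ℂ) * (t.choose k : ℂ)) • W (i + k) t
        + ∑ r ∈ Finset.range R, ∑ᶠ k : ℕ, (((k + j).choose j : ℂ) *
          binom (-(r : ℤ) - 1) (k + j)) •
            I (Y₁ (l + ((i + k : ℕ) : ℤ)) v) (m + n - r - j - 1 - ((i + k : ℕ) : ℂ)) (H₂ r u)
        + ∑ᶠ s : ℕ, binom (-(s : ℤ) - 1) j •
          I (Y₁ (l + i - s - j - 1) (H₁ s v)) (m + n - i) u := by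
    intro i
    set φ : M₁ →ₗ[ℂ] M₃ := LinearMap.applyₗ u ∘ₗ LinearMap.proj (m + n - i : ℂ) ∘ₗ I with hφ
    have hφ' : ∀ w, I w (m + n - i) u = φ w := fun w => rfl
    have E0 : ∀ r : ℕ, EvZero fun k : ℕ => (((k + j).choose j : ℂ) *
        binom (-(r : ℤ) - 1) (k + j)) •
          I (Y₁ (l + ((i + k : ℕ) : ℤ)) v) (m + n - r - j - 1 - ((i + k : ℕ) : ℂ)) (H₂ r u) :=
      fun r => ⟨B, fun k hk => by simp only [hY i k (by omega), map_zero, Pi.zero_apply,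
        LinearMap.zero_apply, smul_zero]⟩
    have hYk : ∀ k : ℕ, Y₁ (l + i + k) v = Y₁ (l + ((i + k : ℕ) : ℤ)) v := fun k => by
      rw [Nat.cast_add, add_assoc]
    rw [hφ', hZ, map_add, map_finsum_evZero, map_finsum_evZero]
    · refine congrArg₂ _ ?_ (finsum_congr fun s => map_smul φ _ _)
      rw [← finsum_sum_comm _ _ fun r _ => (E0 r).hasFiniteSupport, ← finsum_add_evZero]
      · refine finsum_congr fun k => ?_
        rw [map_smul, ← hφ', hC, finsum_eq_sum_range (B := R)
          (f := fun r : ℕ => binom (-(r : ℤ) - 1) (k + j) • _) fun s hs => by simp [hR s hs],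
          smul_add, Finset.smul_sum, hYk]
        congr 1
        · rw [finsum_eq_finsum_add (s := k) (fun t ht => by simp [Nat.choose_eq_zero_of_lt ht])
            ((hWk _).smul _), smul_finsum]
          refine finsum_congr fun t => ?_
          rw [smul_smul, choose_mul_choose_add, hW]
          beta_reduce
          rw [← add_assoc]
          congr 4
          push_cast
          ring_nf
        · refine Finset.sum_congr rfl fun r _ => ?_
          rw [smul_smul]
          congr 3
          push_cast
          ring_nf
      · exact ⟨B, fun k hk => finsum_eq_zero_of_forall_eq_zero fun t => by
          rw [hW0 _ _ (hk.trans (Nat.le_add_left _ _)), smul_zero]⟩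
      · exact evZero_sum fun r _ => E0 r
    · exact ⟨S, fun s hs => by simp [hS s hs]⟩
    · exact ⟨B, fun k hk => by simp only [hYk, hY i k (by omega), map_zero, smul_zero]⟩
  have E1 : EvZero fun i : ℕ => binom m i • ∑ᶠ k : ℕ, ∑ᶠ t : ℕ,
      (((t + j).choose j : ℂ) * (t.choose k : ℂ)) • W (i + k) t :=
    ⟨B, fun i hi => by simp [hW0 _ _ (hi.trans (Nat.le_add_right _ _))]⟩
  have E2 : ∀ r : ℕ, EvZero fun i : ℕ => ∑ᶠ k : ℕ, (binom m i * (((k + j).choose j : ℂ) *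
      binom (-(r : ℤ) - 1) (k + j))) •
        I (Y₁ (l + ((i + k : ℕ) : ℤ)) v) (m + n - r - j - 1 - ((i + k : ℕ) : ℂ)) (H₂ r u) :=
    fun r => ⟨B, fun i hi => finsum_eq_zero_of_forall_eq_zero fun k => by
      simp only [hY i k (by omega), map_zero, Pi.zero_apply, LinearMap.zero_apply, smul_zero]⟩
  have E3 : EvZero fun i : ℕ => binom m i • ∑ᶠ s : ℕ, binom (-(s : ℤ) - 1) j •
      I (Y₁ (l + i - s - j - 1) (H₁ s v)) (m + n - i) u := by
    obtain ⟨C, hC⟩ := exists_common_bound (fun s : ℕ => hY₁ (H₁ s v) (l - s - j - 1)) S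
    refine ⟨C, fun i hi => ?_⟩
    beta_reduce
    rw [finsum_eq_zero_of_forall_eq_zero, smul_zero]
    intro s
    by_cases hs : S ≤ s
    · simp [hS s hs]
    · rw [show l + i - s - j - 1 = l - s - j - 1 + i by ring, hC s (not_le.mp hs) i hi]
      simp
  rw [jacobiIterate, stepTerm, ← h1, ← h3, finsum_eq_sum_range (B := R)
    (f := fun r : ℕ => binom (-(r : ℤ) - 1) j • jacobiIterate Y₁ I l (m - r - j - 1) n v (H₂ r u))
    fun r hr => by simp [jacobiIterate, hR r hr],
    Finset.sum_congr rfl fun r _ => (h2 r).symm,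
    ← finsum_sum_comm _ _ fun r _ => (E2 r).hasFiniteSupport,
    ← finsum_add_evZero E1 (evZero_sum fun r _ => E2 r),
    ← finsum_add_evZero (E1.add (evZero_sum fun r _ => E2 r)) E3]
  refine finsum_congr fun i => ?_
  rw [key, smul_add, smul_add, Finset.smul_sum]
  congr 2
  refine Finset.sum_congr rfl fun r _ => ?_
  rw [smul_finsum]
  refine finsum_congr fun k => ?_
  rw [smul_smul]

/-- If the Jacobi identity holds for the fields `Y₁, Y₂, Y₃` of a vector `b`, then it holds for the
fields of `h(-j-1)b`. -/
theorem jacobi_step (hI : TruncatedOp I) (hY₁ : Truncated Y₁) (hY₂ : Truncated Y₂)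
    (hY₃ : Truncated Y₃) (hH₁ : Truncated H₁) (hH₂ : Truncated H₂) {j : ℕ}
    (hZ₁ : IsNormalProduct H₁ j Y₁ Z₁) (hZ₂ : IsNormalProduct H₂ j Y₂ Z₂)
    (hZ₃ : IsNormalProduct H₃ j Y₃ Z₃) (hC : IsCreative H₁ H₂ H₃ I)
    (hP : HasCommutatorFormula H₁ H₂ H₃ I)
    (hJ : ∀ (l m : ℤ) (n : ℂ) (v : M₁) (u : M₂),
      jacobiLeft Y₃ I l m n v u - jacobiRight Y₂ I l m n v u = jacobiIterate Y₁ I l m n v u)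
    (l m : ℤ) (n : ℂ) (v : M₁) (u : M₂) :
    jacobiLeft Z₃ I l m n v u - jacobiRight Z₂ I l m n v u = jacobiIterate Z₁ I l m n v u := by
  rw [jacobiLeft_step hI hY₃ hH₁ hH₂ hZ₃ hP, jacobiRight_step hY₂ hH₁ hH₂ hZ₂ hP,
    jacobiIterate_step hI hY₁ hH₁ hH₂ hZ₁ hC]
  obtain ⟨S, hS⟩ := hH₁.nat v
  obtain ⟨R, hR⟩ := hH₂.nat u
  simp only [stepTerm]
  rw [add_sub_add_comm, add_sub_add_comm, ← finsum_sub_evZero, ← finsum_sub_evZero,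
    ← finsum_sub_evZero]
  · simp only [← smul_sub, ← map_sub, hJ]
  · exact ⟨S, fun s hs => by simp [jacobiLeft, hS s hs]⟩
  · exact ⟨S, fun s hs => by simp [jacobiRight, hS s hs]⟩
  · exact ⟨R, fun s hs => by simp [jacobiLeft, hR s hs]⟩
  · exact ⟨R, fun s hs => by simp [jacobiRight, hR s hs]⟩
  · exact ((evZero_jacobiLeft hI hY₃ ..).map fun k => H₃ (-((k + j : ℕ) : ℤ) - 1)).smul _
  · exact ((evZero_jacobiRight hY₂ ..).map fun k => H₃ (-((k + j : ℕ) : ℤ) - 1)).smul _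

end JacobiStep

/-! ### The Heisenberg algebra on the Fock space -/

open MvPolynomial in
/-- The operator `h(m)` on the Fock space `M(1, mu)`: the scalar `mu` for `m = 0`, the derivation
`m ∂/∂X (m-1)` for `m > 0`, and multiplication by `X (-m-1)` for `m < 0`. -/
noncomputable def heis (mu : ℂ) : ℤ → Module.End ℂ (MvPolynomial ℕ ℂ)
  | .ofNat 0 => mu • LinearMap.id
  | .ofNat (r + 1) => ((r : ℂ) + 1) • (pderiv r).toLinearMap
  | .negSucc k => LinearMap.mulLeft ℂ (X k)

section Heisenberg

open MvPolynomial

variable (mu : ℂ)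

@[simp] theorem heis_zero (u : MvPolynomial ℕ ℂ) : heis mu 0 u = mu • u := rfl

theorem heis_succ (r : ℕ) (u : MvPolynomial ℕ ℂ) :
    heis mu ((r : ℤ) + 1) u = ((r : ℂ) + 1) • pderiv r u := rfl

theorem heis_neg (k : ℕ) (u : MvPolynomial ℕ ℂ) : heis mu (-(k : ℤ) - 1) u = X k * u := by
  rw [show -(k : ℤ) - 1 = Int.negSucc k by rw [Int.negSucc_eq]; ring]
  rfl

theorem heis_X_mul (m : ℤ) (j : ℕ) (u : MvPolynomial ℕ ℂ) :
    heis mu m (X j * u) = X j * heis mu m u + if m = j + 1 then (m : ℂ) • u else 0 := by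
  rcases m with (_ | r) | k
  · rw [if_neg (by simp; omega)]
    change mu • _ = X j * (mu • _) + 0
    rw [add_zero]
    exact (mul_smul_comm mu (X j) u).symm
  · change heis mu ((r : ℤ) + 1) _ = X j * heis mu ((r : ℤ) + 1) _ + _
    rw [heis_succ, heis_succ, Derivation.leibniz, pderiv_X]
    by_cases h : r = j
    · subst h
      simp [smul_eq_C_mul]
      ring
    · rw [if_neg (by simpa using h), Pi.single_eq_of_ne (Ne.symm h)]
      simp
  · rw [if_neg (by omega)]
    change X k * _ = X j * (X k * _) + 0
    ring

theorem truncated_heis : Truncated (heis mu) := by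
  intro w
  induction w using MvPolynomial.induction_on with
  | C a =>
    intro m
    refine ⟨(1 - m).toNat, fun i hi => ?_⟩
    obtain ⟨r, hr⟩ : ∃ r : ℕ, m + i = (r : ℤ) + 1 := ⟨(m + i - 1).toNat, by omega⟩
    simp [hr, heis_succ]
  | add p q hp hq =>
    intro m
    simpa using (hp m).add (hq m)
  | mul_X p j hp =>
    intro m
    obtain ⟨B, hB⟩ := hp m
    refine ⟨max B (j + 2 - m).toNat, fun i hi => ?_⟩
    have := hB i (by omega)
    beta_reduce at this ⊢
    rw [mul_comm, heis_X_mul, this, if_neg (by omega)]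
    simp

end Heisenberg

section FieldPlus

open MvPolynomial

variable (lam mu : ℂ)

/-- The inclusion `M(1, mu) → M(1, mu) ⊗ ℂ[z⁻¹]`. -/
noncomputable abbrev toNeg : MvPolynomial ℕ ℂ →ₐ[ℂ] M1Neg mu :=
  MvPolynomial.mapAlgHom (Algebra.ofId ℂ (Polynomial ℂ))

theorem toNeg_X (i : ℕ) : toNeg mu (X i) = X i := by simp [toNeg]

theorem annihilation_X_mul (c : ℕ → Polynomial ℂ) (i : ℕ) (x : M1Neg mu) :
    annihilation mu c (X i * x)
      = X i * annihilation mu c x + C (((i : Polynomial ℂ) + 1) * c i) * x := by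
  simp only [annihilation, Derivation.coeFn_coe, Derivation.leibniz, mkDerivation_X, smul_eq_mul]
  ring

theorem annihilation_C (c : ℕ → Polynomial ℂ) (a : Polynomial ℂ) :
    annihilation mu c (C a) = 0 := by
  simp [annihilation]

theorem annihilation_comm (c d : ℕ → Polynomial ℂ) (x : M1Neg mu) :
    annihilation mu c (annihilation mu d x) = annihilation mu d (annihilation mu c x) := by
  induction x using MvPolynomial.induction_on with
  | C a => simp [annihilation_C]
  | add p q hp hq => simp [hp, hq]
  | mul_X p i hp =>
    rw [mul_comm]
    have h : ∀ (e : ℕ → Polynomial ℂ) (a : Polynomial ℂ) (y : M1Neg mu),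
        annihilation mu e (C a * y) = C a * annihilation mu e y := by
      intro e a y
      rw [← smul_eq_C_mul, ← smul_eq_C_mul, map_smul]
    simp only [annihilation_X_mul, map_add, hp, h]
    ring

theorem fieldPlus_comm (i j : ℕ) (x : M1Neg mu) :
    fieldPlus mu i (fieldPlus mu j x) = fieldPlus mu j (fieldPlus mu i x) := by
  simp only [fieldPlus, LinearMap.add_apply, LinearMap.smul_apply, LinearMap.id_apply, map_add,
    map_smul]
  simp only [smul_add, smul_smul]
  rw [annihilation_comm, mul_comm (Polynomial.monomial (j + 1) _)]
  abel

/-- `∑_{m ≥ 0}`-part of `∂^{(j)}h(z)`, expanded in the modes `h(r)`. -/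
theorem fieldPlus_toNeg (j : ℕ) (u : MvPolynomial ℕ ℂ) :
    ∃ R₀, ∀ R, R₀ ≤ R → fieldPlus mu j (toNeg mu u) = ∑ r ∈ Finset.range R,
      (Polynomial.monomial (r + j + 1) (binom (-(r : ℤ) - 1) j)) • toNeg mu (heis mu r u) := by
  have key : ∃ R₀, ∀ R, R₀ ≤ R → annihilation mu
      (fun p => Polynomial.monomial (p + j + 2) (binom (-(p : ℤ) - 2) j)) (toNeg mu u)
        = ∑ r ∈ Finset.range R, (Polynomial.monomial (r + j + 2) (binom (-(r : ℤ) - 2) j)) •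
          toNeg mu (heis mu (r + 1) u) := by
    induction u using MvPolynomial.induction_on with
    | C a => exact ⟨0, fun R _ => by simp [annihilation_C, heis_succ, toNeg]⟩
    | add p q hp hq =>
      obtain ⟨A, hA⟩ := hp
      obtain ⟨B, hB⟩ := hq
      refine ⟨max A B, fun R hR => ?_⟩
      simp only [map_add, hA R (by omega), hB R (by omega), smul_add, Finset.sum_add_distrib]
    | mul_X p i hp =>
      obtain ⟨A, hA⟩ := hp
      refine ⟨max A (i + 1), fun R hR => ?_⟩
      have h : ∀ r : ℕ, (Polynomial.monomial (r + j + 2) (binom (-(r : ℤ) - 2) j)) •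
          toNeg mu (heis mu (r + 1) (X i * p))
          = X i * ((Polynomial.monomial (r + j + 2) (binom (-(r : ℤ) - 2) j)) •
            toNeg mu (heis mu (r + 1) p)) + if r = i then
              C (((i : Polynomial ℂ) + 1) *
                Polynomial.monomial (i + j + 2) (binom (-(i : ℤ) - 2) j)) * toNeg mu p else 0 := by
        intro r
        rw [heis_X_mul, map_add, map_mul, toNeg_X, smul_add, mul_smul_comm]
        congr 1
        by_cases hr : r = i
        · subst hr
          rw [if_pos rfl, if_pos rfl, map_smul, smul_eq_C_mul,
            algebra_compatible_smul (Polynomial ℂ), smul_eq_C_mul,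
            ← mul_assoc, ← C_mul, mul_comm (Polynomial.monomial _ _)]
          simp
        · rw [if_neg hr, if_neg (by omega), map_zero, smul_zero]
      rw [mul_comm, map_mul, toNeg_X, annihilation_X_mul, hA R (by omega), Finset.sum_congr rfl
        fun r _ => h r, Finset.sum_add_distrib, ← Finset.mul_sum]
      simp only [Finset.sum_ite_eq', Finset.mem_range]
      rw [if_pos (by omega)]
  obtain ⟨R₀, hR₀⟩ := key
  refine ⟨R₀ + 1, fun R hR => ?_⟩
  obtain ⟨R, rfl⟩ : ∃ R', R = R' + 1 := ⟨R - 1, by omega⟩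
  rw [Finset.sum_range_succ', fieldPlus, LinearMap.add_apply]
  change _ + annihilation mu (fun p => Polynomial.monomial (p + j + 2) (binom (-(p : ℤ) - 2) j))
    (toNeg mu u) = _
  rw [hR₀ R (by omega), add_comm]
  congr 1
  · refine Finset.sum_congr rfl fun r _ => ?_
    push_cast
    rw [show r + 1 + j + 1 = r + j + 2 by ring, show -((r : ℤ) + 1) - 1 = -(r : ℤ) - 2 by ring]
  · simp only [Nat.cast_zero, heis_zero, LinearMap.smul_apply, LinearMap.id_apply]
    rw [map_smul, ← algebraMap_smul (Polynomial ℂ) mu, smul_smul, Polynomial.algebraMap_eq,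
      Polynomial.monomial_mul_C, mul_comm mu]
    simp [binom]

end FieldPlus

/-! ### Normal ordering -/

section Series

open MvPolynomial

variable (lam mu nu : ℂ)

/-- The substitution `ℂ[z⁻¹] → M(1, nu)((z))`. -/
noncomputable def negToLaurent : Polynomial ℂ →+* LaurentSeries (M1 nu) :=
  Polynomial.eval₂RingHom (HahnSeries.C.comp MvPolynomial.C)
      (HahnSeries.single (-1 : ℤ) (1 : M1 nu))

theorem negToLaurent_monomial (n : ℕ) (a : ℂ) :
    negToLaurent nu (Polynomial.monomial n a) = HahnSeries.single (-(n : ℤ)) (C a) := by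
  simp [negToLaurent, HahnSeries.single_pow, HahnSeries.C_apply]

theorem negToLaurent_monomial_mul_coeff (n : ℕ) (a : ℂ) (f : LaurentSeries (M1 nu)) (k : ℤ) :
    (negToLaurent nu (Polynomial.monomial n a) * f).coeff k = a • f.coeff (k + n) := by
  rw [negToLaurent_monomial, smul_eq_C_mul]
  have := HahnSeries.coeff_single_mul_add (r := (C a : M1 nu)) (x := f) (a := k + n)
    (b := -(n : ℤ))
  rwa [add_neg_cancel_right] at this

theorem ofPowerSeries_mul_coeff (f : PowerSeries (M1 nu)) (g : LaurentSeries (M1 nu)) (k : ℤ) :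
    (HahnSeries.ofPowerSeries ℤ _ f * g).coeff k
      = ∑ᶠ t : ℕ, PowerSeries.coeff t f * g.coeff (k - t) := by
  have key : ∀ (p : PowerSeries (M1 nu)) (k : ℤ),
      (HahnSeries.ofPowerSeries ℤ _ f * HahnSeries.ofPowerSeries ℤ _ p).coeff k
        = ∑ᶠ t : ℕ, PowerSeries.coeff t f * (HahnSeries.ofPowerSeries ℤ _ p).coeff (k - t) := by
    intro p k
    rw [← map_mul, PowerSeries.coeff_coe]
    split_ifs with hk
    · refine (finsum_eq_zero_of_forall_eq_zero fun t => ?_).symm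
      rw [PowerSeries.coeff_coe, if_pos (by omega), mul_zero]
    · obtain ⟨n, rfl⟩ := Int.eq_ofNat_of_zero_le (not_lt.mp hk)
      rw [Int.natAbs_natCast, PowerSeries.coeff_mul,
        Finset.Nat.sum_antidiagonal_eq_sum_range_succ
          (fun i j => PowerSeries.coeff i f * PowerSeries.coeff j p),
        finsum_eq_sum_range (B := n + 1)]
      · refine Finset.sum_congr rfl fun t ht => ?_
        have ht : t < n + 1 := Finset.mem_range.mp ht
        rw [PowerSeries.coeff_coe, if_neg (by omega)]
        congr 3
        omega
      · intro t ht
        rw [PowerSeries.coeff_coe, if_pos (by omega), mul_zero]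
  -- reduction to a power series `g` by splitting off the power of `z` given by its order
  have hsingle : ∀ (h : LaurentSeries (M1 nu)) (m : ℤ),
      (HahnSeries.single g.order (1 : M1 nu) * h).coeff m = h.coeff (m - g.order) := by
    intro h m
    have := HahnSeries.coeff_single_mul_add (r := (1 : M1 nu)) (x := h) (a := m - g.order)
      (b := g.order)
    rwa [sub_add_cancel, one_mul] at this
  rw [← LaurentSeries.single_order_mul_powerSeriesPart g, mul_left_comm, hsingle, key]
  simp only [hsingle, sub_right_comm]

theorem evZero_coeff (g : LaurentSeries (M1 nu)) (k : ℤ) :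
    EvZero fun t : ℕ => g.coeff (k - t) := by
  refine ⟨(k - g.order + 1).toNat, fun t ht => ?_⟩
  exact HahnSeries.coeff_eq_zero_of_lt_order (by omega)

theorem shift_smul (c : Polynomial ℂ) (x : M1Neg mu) :
    shift lam mu (c • x) = negToLaurent (lam + mu) c * shift lam mu x := by
  rw [smul_eq_C_mul]
  change MvPolynomial.eval₂ _ _ _ = _ * MvPolynomial.eval₂ _ _ _
  rw [MvPolynomial.eval₂_mul, MvPolynomial.eval₂_C]
  rfl

theorem shift_X_mul (i : ℕ) (x : M1Neg mu) :
    shift lam mu (X i * x) = HahnSeries.C (X i) * shift lam mu x := by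
  change MvPolynomial.eval₂ _ _ _ = _ * MvPolynomial.eval₂ _ _ _
  rw [MvPolynomial.eval₂_mul, MvPolynomial.eval₂_X]

theorem normalOrdered_smul (t : List ℕ) (c : Polynomial ℂ) (x : M1Neg mu) :
    normalOrdered lam mu t (c • x)
      = negToLaurent (lam + mu) c * normalOrdered lam mu t x := by
  induction t generalizing x with
  | nil =>
    simp only [normalOrdered, LinearMap.comp_apply, LinearMap.coe_restrictScalars, map_smul,
      shift_smul]
    exact mul_left_comm _ _ _
  | cons i t ih =>
    simp only [normalOrdered, LinearMap.add_apply, LinearMap.comp_apply,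
      LinearMap.coe_restrictScalars, map_smul, ih, mul_add]
    congr 1
    exact mul_left_comm _ _ _

/-- Annihilation parts commute with each other and so do creation parts, so the order of the factors
in a normally ordered product does not matter. -/
theorem normalOrdered_perm {s t : List ℕ} (h : s.Perm t) :
    normalOrdered lam mu s = normalOrdered lam mu t := by
  induction h with
  | nil => rfl
  | cons i _ ih => simp only [normalOrdered, ih]
  | swap i j t =>
    refine LinearMap.ext fun x => ?_
    simp only [normalOrdered, LinearMap.add_apply, LinearMap.comp_apply,
      LinearMap.coe_restrictScalars, map_add, fieldPlus_comm mu i j x]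
    rw [show ∀ f g y, mulSeries (lam + mu) f (mulSeries (lam + mu) g y)
      = mulSeries (lam + mu) g (mulSeries (lam + mu) f y) from fun f g y => mul_left_comm f g y]
    abel
  | trans _ _ h₁ h₂ => exact h₁.trans h₂

/-- The extension of `z^{-lam * mu} I(v, z)` to vectors `u` with coefficients in `ℂ[z⁻¹]`. -/
noncomputable def latticeSeriesExt :
    M1 lam →ₗ[ℂ] M1Neg mu →ₗ[ℂ] LaurentSeries (M1 (lam + mu)) :=
  (MvPolynomial.basisMonomials ℕ ℂ).constr ℂ fun s =>
    normalOrdered lam mu ((Finsupp.toMultiset s).sort (· ≤ ·))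

theorem latticeSeriesExt_monomial (s : ℕ →₀ ℕ) (a : ℂ) :
    latticeSeriesExt lam mu (monomial s a)
      = a • normalOrdered lam mu ((Finsupp.toMultiset s).sort (· ≤ ·)) := by
  have := (MvPolynomial.basisMonomials ℕ ℂ).constr_basis ℂ (fun s =>
    normalOrdered lam mu ((Finsupp.toMultiset s).sort (· ≤ ·))) s
  rw [coe_basisMonomials] at this
  rw [← this, show monomial s a = a • monomial s (1 : ℂ) by simp [smul_monomial]]
  exact map_smul _ _ _

theorem latticeSeries_eq (v : M1 lam) (u : M1 mu) :
    latticeSeries lam mu v u = latticeSeriesExt lam mu v (toNeg mu u) := by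
  have : latticeSeries lam mu = (LinearMap.lcomp ℂ _ (toNeg mu).toLinearMap)
      ∘ₗ latticeSeriesExt lam mu := by
    refine (MvPolynomial.basisMonomials ℕ ℂ).ext fun s => ?_
    rw [latticeSeries, LinearMap.comp_apply, latticeSeriesExt, Module.Basis.constr_basis,
      Module.Basis.constr_basis]
    rfl
  rw [this]
  rfl

theorem latticeSeriesExt_smul (v : M1 lam) (c : Polynomial ℂ) (x : M1Neg mu) :
    latticeSeriesExt lam mu v (c • x)
      = negToLaurent (lam + mu) c * latticeSeriesExt lam mu v x := by
  induction v using MvPolynomial.induction_on' with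
  | monomial s a =>
    rw [latticeSeriesExt_monomial, LinearMap.smul_apply, LinearMap.smul_apply,
      normalOrdered_smul, smul_series, smul_series, mul_left_comm]
  | add p q hp hq => simp only [map_add, LinearMap.add_apply, hp, hq, mul_add]

theorem latticeSeriesExt_X_mul (j : ℕ) (v : M1 lam) (x : M1Neg mu) :
    latticeSeriesExt lam mu (X j * v) x
      = HahnSeries.ofPowerSeries ℤ _ (fieldMinus (lam + mu) j) * latticeSeriesExt lam mu v x
        + latticeSeriesExt lam mu v (fieldPlus mu j x) := by
  induction v using MvPolynomial.induction_on' with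
  | monomial s a =>
    have hperm : ((Finsupp.toMultiset (Finsupp.single j 1 + s)).sort (· ≤ ·)).Perm
        (j :: (Finsupp.toMultiset s).sort (· ≤ ·)) := by
      rw [← Multiset.coe_eq_coe, ← Multiset.cons_coe, Multiset.sort_eq, Multiset.sort_eq]
      simp
    rw [X, monomial_mul, one_mul, latticeSeriesExt_monomial, latticeSeriesExt_monomial,
      normalOrdered_perm _ _ hperm]
    simp only [normalOrdered, LinearMap.smul_apply, LinearMap.add_apply, LinearMap.comp_apply,
      LinearMap.coe_restrictScalars, smul_add]
    congr 1
    rw [smul_series, smul_series, mul_left_comm]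
    rfl
  | add p q hp hq =>
    simp only [mul_add, map_add, LinearMap.add_apply, hp, hq]
    abel

/-- The coefficients of `z^{-lam * mu} :∂^{(j)}h(z) I(v, z): u`. -/
theorem latticeSeries_X_mul_coeff (j : ℕ) (v : M1 lam) (u : M1 mu) (k : ℤ) :
    (latticeSeries lam mu (X j * v) u).coeff k
      = ∑ᶠ t : ℕ, ((t + j).choose j : ℂ) •
          (X (t + j) * (latticeSeries lam mu v u).coeff (k - t))
        + ∑ᶠ r : ℕ, binom (-(r : ℤ) - 1) j •
          (latticeSeries lam mu v (heis mu r u)).coeff (k + r + j + 1) := by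
  simp only [latticeSeries_eq]
  rw [latticeSeriesExt_X_mul, HahnSeries.coeff_add, ofPowerSeries_mul_coeff]
  congr 1
  · refine finsum_congr fun t => ?_
    rw [fieldMinus, PowerSeries.coeff_mk, smul_mul_assoc]
  · obtain ⟨R₀, hR₀⟩ := fieldPlus_toNeg mu j u
    obtain ⟨R₁, hR₁⟩ := (truncated_heis mu).nat u
    rw [hR₀ (max R₀ R₁) (le_max_left _ _), map_sum, HahnSeries.coeff_sum,
      finsum_eq_sum_range (B := max R₀ R₁) fun r hr => by simp [hR₁ r (le_of_max_le_right hr)]]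
    refine Finset.sum_congr rfl fun r _ => ?_
    rw [latticeSeriesExt_smul, negToLaurent_monomial_mul_coeff]
    push_cast
    simp only [add_assoc]

end Series

/-! ### The exponentials in `I(e^lam, z)` -/

section Exponential

open MvPolynomial

variable (lam mu nu : ℂ)

theorem pow_X_mul (D : Module.End (Polynomial ℂ) (M1Neg mu)) (a : ℕ → Polynomial ℂ)
    (hD : ∀ i x, D (X i * x) = X i * D x + a i • x) (i : ℕ) (x : M1Neg mu) (k : ℕ) :
    (D ^ (k + 1)) (X i * x) = X i * (D ^ (k + 1)) x + ((k + 1 : ℕ) : ℂ) • a i • (D ^ k) x := by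
  have hp : ∀ n y, (D ^ (n + 1)) y = (D ^ n) (D y) := fun n y => by
    rw [pow_succ, Module.End.mul_apply]
  induction k generalizing x with
  | zero => simp [hD]
  | succ k ih =>
    rw [hp, hD, map_add, ih, map_smul, hp (k + 1), hp k x]
    push_cast
    module

/-- If `D` is `ℂ[z⁻¹]`-linear with `D 1 = 0` and `[D, X i]` is the scalar `a i`, then on a monomial
of degree `d` all powers of `D` beyond the `d`-th vanish. -/
theorem pow_monomial_eq_zero (D : Module.End (Polynomial ℂ) (M1Neg mu)) (a : ℕ → Polynomial ℂ)
    (h1 : D 1 = 0) (hD : ∀ i x, D (X i * x) = X i * D x + a i • x) (d : ℕ) (s : ℕ →₀ ℕ)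
    (hs : s.degree = d) (k : ℕ) (hk : d < k) : (D ^ k) (monomial s 1) = 0 := by
  obtain ⟨k, rfl⟩ : ∃ k', k = k' + 1 := ⟨k - 1, by omega⟩
  induction d generalizing s k with
  | zero =>
    obtain rfl : s = 0 := (Finsupp.degree_eq_zero_iff s).mp hs
    rw [pow_succ, Module.End.mul_apply, show monomial (0 : ℕ →₀ ℕ) (1 : Polynomial ℂ) = 1 from rfl,
      h1, map_zero]
  | succ d ih =>
    obtain ⟨k, rfl⟩ : ∃ k', k = k' + 1 := ⟨k - 1, by omega⟩
    obtain ⟨i, hi⟩ : ∃ i, s i ≠ 0 := by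
      by_contra! h
      obtain rfl : s = 0 := Finsupp.ext h
      simp at hs
    have hs' := Finsupp.sub_add_single_one_cancel hi
    set t := s - Finsupp.single i 1
    have ht : t.degree = d := by
      have := congrArg Finsupp.degree hs'
      rw [map_add, Finsupp.degree_single, hs] at this
      omega
    have hm : monomial s (1 : Polynomial ℂ) = X i * monomial t 1 := by
      rw [X, monomial_mul, one_mul, add_comm, hs']
    rw [hm, pow_X_mul mu D a hD, ih t ht (k + 1) (by omega), ih t ht k (by omega)]
    simp

theorem expLowering_monomial (D : Module.End (Polynomial ℂ) (M1Neg mu)) (a : ℕ → Polynomial ℂ)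
    (h1 : D 1 = 0) (hD : ∀ i x, D (X i * x) = X i * D x + a i • x) (s : ℕ →₀ ℕ) (N : ℕ)
    (hN : s.degree < N) : expLowering mu D (monomial s 1)
      = ∑ k ∈ Finset.range N, ((k.factorial : ℂ)⁻¹) • (D ^ k) (monomial s 1) := by
  have := (MvPolynomial.basisMonomials ℕ (Polynomial ℂ)).constr_basis (Polynomial ℂ) (fun s =>
    ∑ k ∈ Finset.range (s.degree + 1),
      ((k.factorial : ℂ)⁻¹) • (D ^ k) (MvPolynomial.monomial s 1)) s
  rw [coe_basisMonomials] at this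
  refine this.trans (Finset.sum_subset (Finset.range_subset_range.mpr hN) fun k _ hk => ?_)
  rw [pow_monomial_eq_zero mu D a h1 hD _ s rfl k (by simpa using hk), smul_zero]

/-- If `D 1 = 0` and `[D, X i]` is the scalar `a i`, then `exp D` is the substitution
`X i ↦ X i + a i`. -/
theorem expLowering_X_mul (D : Module.End (Polynomial ℂ) (M1Neg mu)) (a : ℕ → Polynomial ℂ)
    (h1 : D 1 = 0) (hD : ∀ i x, D (X i * x) = X i * D x + a i • x) (i : ℕ) (x : M1Neg mu) :
    expLowering mu D (X i * x) = X i * expLowering mu D x + a i • expLowering mu D x := by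
  induction x using MvPolynomial.induction_on' with
  | add p q hp hq => simp only [mul_add, map_add, hp, hq, smul_add]; abel
  | monomial s c =>
    have hc : monomial s c = c • monomial s (1 : Polynomial ℂ) := by simp [smul_monomial]
    have hm : X i * monomial s (1 : Polynomial ℂ) = monomial (Finsupp.single i 1 + s) 1 := by
      rw [X, monomial_mul, one_mul]
    have hdeg : (Finsupp.single i 1 + s).degree < s.degree + 2 := by
      rw [map_add, Finsupp.degree_single]; omega
    have main : expLowering mu D (X i * monomial s 1)
        = X i * expLowering mu D (monomial s 1) + a i • expLowering mu D (monomial s 1) := by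
      rw [hm, expLowering_monomial mu D a h1 hD _ _ hdeg, ← hm, Finset.sum_range_succ']
      simp only [pow_X_mul mu D a hD, smul_add, Finset.sum_add_distrib]
      rw [add_right_comm]
      congr 1
      · rw [expLowering_monomial mu D a h1 hD _ (s.degree + 2) (by omega),
          Finset.sum_range_succ' _ (s.degree + 1), mul_add, Finset.mul_sum]
        simp only [mul_smul_comm, pow_zero, Module.End.one_apply]
      · rw [expLowering_monomial mu D a h1 hD _ (s.degree + 1) (by omega), Finset.smul_sum]
        refine Finset.sum_congr rfl fun k _ => ?_
        rw [smul_smul, smul_comm (a i), Nat.factorial_succ]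
        congr 1
        have h2 : ((k + 1 : ℕ) : ℂ) ≠ 0 := Nat.cast_ne_zero.mpr k.succ_ne_zero
        have h3 : (k.factorial : ℂ) ≠ 0 := Nat.cast_ne_zero.mpr k.factorial_ne_zero
        rw [Nat.cast_mul]
        field_simp
    rw [hc, mul_smul_comm, map_smul, map_smul, main, smul_add, mul_smul_comm, smul_comm c]

theorem expLowering_one (D : Module.End (Polynomial ℂ) (M1Neg mu)) : expLowering mu D 1 = 1 := by
  have := (MvPolynomial.basisMonomials ℕ (Polynomial ℂ)).constr_basis (Polynomial ℂ) (fun s =>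
    ∑ k ∈ Finset.range (s.degree + 1),
      ((k.factorial : ℂ)⁻¹) • (D ^ k) (MvPolynomial.monomial s 1)) 0
  rw [coe_basisMonomials] at this
  refine this.trans ?_
  simp

theorem expPlus_X_mul (i : ℕ) (x : M1Neg mu) :
    expPlus lam mu (X i * x)
      = X i * expPlus lam mu x + Polynomial.monomial (i + 1) (-lam) • expPlus lam mu x := by
  rw [expPlus, expLowering_X_mul _ _ (fun i => Polynomial.monomial (i + 1) (-lam))]
  · rw [← C_1, annihilation_C]
  · intro i x
    rw [annihilation_X_mul, ← smul_eq_C_mul]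
    congr 2
    rw [show (i : Polynomial ℂ) + 1 = Polynomial.C ((i : ℂ) + 1) by simp,
      Polynomial.C_mul_monomial]
    congr 1
    have : (i : ℂ) + 1 ≠ 0 := Nat.cast_add_one_ne_zero i
    field_simp

/-- The coefficient of `z^k` in `z^{-lam * mu} I(e^lam, z) u`. -/
noncomputable def vacuumCoeff (k : ℤ) (u : MvPolynomial ℕ ℂ) : MvPolynomial ℕ ℂ :=
  (latticeSeries lam mu 1 u).coeff k

theorem latticeSeries_one (u : M1 mu) : latticeSeries lam mu 1 u
    = HahnSeries.ofPowerSeries ℤ _ (expMinus lam mu) *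
      shift lam mu (expPlus lam mu (toNeg mu u)) := by
  rw [latticeSeries_eq, show (1 : M1 lam) = monomial 0 1 from rfl, latticeSeriesExt_monomial,
    one_smul]
  simp only [map_zero, Multiset.sort_zero]
  rfl

/-- `I(e^lam, z) h(-i-1) = (h(-i-1) - lam z^{-i-1}) I(e^lam, z)`. -/
theorem vacuumCoeff_X_mul (i : ℕ) (k : ℤ) (u : MvPolynomial ℕ ℂ) :
    vacuumCoeff lam mu k (X i * u)
      = X i * vacuumCoeff lam mu k u - lam • vacuumCoeff lam mu (k + i + 1) u := by
  have h : latticeSeries lam mu 1 (X i * u) = HahnSeries.C (X i) * latticeSeries lam mu 1 u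
      + negToLaurent (lam + mu) (Polynomial.monomial (i + 1) (-lam)) *
        latticeSeries lam mu 1 u := by
    rw [latticeSeries_one, latticeSeries_one, map_mul, toNeg_X, expPlus_X_mul, map_add,
      shift_X_mul, shift_smul]
    ring
  rw [vacuumCoeff, h, HahnSeries.coeff_add, negToLaurent_monomial_mul_coeff, vacuumCoeff,
    vacuumCoeff, HahnSeries.C_mul_eq_smul, HahnSeries.coeff_smul, smul_eq_mul]
  push_cast
  simp only [neg_smul, add_assoc, sub_eq_add_neg]

theorem vacuumCoeff_one (k : ℤ) : vacuumCoeff lam mu k 1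
    = (HahnSeries.ofPowerSeries ℤ _ (expMinus lam mu)).coeff k := by
  have : shift lam mu 1 = 1 := by
    change MvPolynomial.eval₂ _ _ _ = _
    simp
  rw [vacuumCoeff, latticeSeries_one, map_one, expPlus, expLowering_one, this, mul_one]

theorem vacuumCoeff_one_neg (k : ℤ) (hk : k < 0) : vacuumCoeff lam mu k 1 = 0 := by
  rw [vacuumCoeff_one, PowerSeries.coeff_coe, if_pos hk]

theorem vacuumCoeff_add (k : ℤ) (u v : MvPolynomial ℕ ℂ) :
    vacuumCoeff lam mu k (u + v) = vacuumCoeff lam mu k u + vacuumCoeff lam mu k v := by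
  simp [vacuumCoeff]

theorem vacuumCoeff_smul (k : ℤ) (c : ℂ) (u : MvPolynomial ℕ ℂ) :
    vacuumCoeff lam mu k (c • u) = c • vacuumCoeff lam mu k u := by
  simp [vacuumCoeff]

/-- The exponent `∑_{n>0} (lam h(-n) / n) z^n`. -/
noncomputable def creationExponent : PowerSeries (MvPolynomial ℕ ℂ) :=
  PowerSeries.X * PowerSeries.mk fun i : ℕ => (lam / ((i : ℂ) + 1)) • X i

theorem creationExponent_hasSubst : PowerSeries.HasSubst (creationExponent lam) := by
  apply PowerSeries.HasSubst.of_constantCoeff_zero'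
  simp [creationExponent]

/-- The exponential series over `ℂ` in `expMinus` may be replaced by the one over the ring of
coefficients, to which the chain rule for formal substitutions applies. -/
theorem expMinus_eq :
    expMinus lam mu = (PowerSeries.exp (MvPolynomial ℕ ℂ)).subst (creationExponent lam) := by
  ext1 n
  change PowerSeries.coeff n ((PowerSeries.exp ℂ).subst (creationExponent lam)) = _
  rw [PowerSeries.coeff_subst' (creationExponent_hasSubst lam),
    PowerSeries.coeff_subst' (creationExponent_hasSubst lam)]
  refine finsum_congr fun d => ?_
  rw [PowerSeries.coeff_exp, PowerSeries.coeff_exp, smul_eq_mul]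
  simp [smul_eq_C_mul]

theorem vacuumCoeff_zero_one : vacuumCoeff lam mu 0 1 = 1 := by
  rw [vacuumCoeff_one, PowerSeries.coeff_coe, if_neg (by simp), expMinus_eq, Int.natAbs_zero,
    PowerSeries.coeff_subst' (creationExponent_hasSubst lam), finsum_eq_single _ 0]
  · simp
  · intro d hd
    simp [creationExponent, hd]

theorem derivative_creationExponent : PowerSeries.derivative _ (creationExponent lam)
    = PowerSeries.mk fun i : ℕ => lam • (X i : MvPolynomial ℕ ℂ) := by
  ext1 n
  rw [PowerSeries.coeff_derivative, creationExponent, PowerSeries.coeff_succ_X_mul,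
    PowerSeries.coeff_mk, PowerSeries.coeff_mk, smul_mul_assoc, mul_comm,
    show ((n : MvPolynomial ℕ ℂ) + 1) = C ((n : ℂ) + 1) by simp, ← smul_eq_C_mul, smul_smul]
  congr 1
  have : (n : ℂ) + 1 ≠ 0 := Nat.cast_add_one_ne_zero n
  field_simp

/-- The differential equation `d/dz E(z) = lam (∑ₜ h(-t-1) z^t) E(z)` of the exponential
`E(z) = I(e^lam, z) e^mu`, without its factor `z^{lam * mu}`. -/
theorem mul_vacuumCoeff_one (k : ℤ) : (k : ℂ) • vacuumCoeff lam mu k 1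
    = lam • ∑ᶠ t : ℕ, X t * vacuumCoeff lam mu (k - 1 - t) 1 := by
  have h : PowerSeries.derivative _ (expMinus lam mu) = expMinus lam mu *
      (PowerSeries.mk fun i : ℕ => lam • (X i : MvPolynomial ℕ ℂ)) := by
    rw [expMinus_eq, PowerSeries.derivative_subst (creationExponent_hasSubst lam),
      PowerSeries.derivative_exp, derivative_creationExponent]
  have h2 : lam • ∑ᶠ t : ℕ, X t * vacuumCoeff lam mu (k - 1 - t) 1
      = (HahnSeries.ofPowerSeries ℤ _ (PowerSeries.derivative _ (expMinus lam mu))).coeff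
        (k - 1) := by
    rw [h, mul_comm, map_mul, ofPowerSeries_mul_coeff, smul_finsum]
    refine finsum_congr fun t => ?_
    rw [PowerSeries.coeff_mk, vacuumCoeff_one, smul_mul_assoc]
  rw [h2, vacuumCoeff_one, PowerSeries.coeff_coe, PowerSeries.coeff_coe]
  rcases lt_trichotomy k 0 with hk | rfl | hk
  · rw [if_pos hk, if_pos (by omega), smul_zero]
  · simp
  · obtain ⟨n, rfl⟩ : ∃ n : ℕ, k = n + 1 := ⟨(k - 1).toNat, by omega⟩
    rw [if_neg (by omega), if_neg (by omega), PowerSeries.coeff_derivative,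
      show ((n : ℤ) + 1).natAbs = n + 1 by omega, show ((n : ℤ) + 1 - 1).natAbs = n by omega,
      smul_eq_C_mul, mul_comm]
    simp

end Exponential

/-! ### Commutators with, and the derivative of, `I(e^lam, z)` -/

section VacuumRelations

open MvPolynomial

variable (lam mu : ℂ)

theorem vacuumCoeff_evZero (k : ℤ) (u : MvPolynomial ℕ ℂ) :
    EvZero fun t : ℕ => vacuumCoeff lam mu (k - t) u :=
  evZero_coeff (lam + mu) (latticeSeries lam mu 1 u) k

theorem vacuumCoeff_C (k : ℤ) (a : ℂ) :
    vacuumCoeff lam mu k (C a) = a • vacuumCoeff lam mu k 1 := by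
  rw [← vacuumCoeff_smul, smul_eq_C_mul, mul_one]

/-- The relation `[h(m), I(e^lam, z)] = lam z^m I(e^lam, z)` on `e^mu` for `m > 0`, by induction on
the exponent of `z` through the differential equation `mul_vacuumCoeff_one`. -/
theorem heis_vacuumCoeff_one (nu : ℂ) (r : ℕ) (k : ℤ) :
    heis nu ((r : ℤ) + 1) (vacuumCoeff lam mu k 1) = lam • vacuumCoeff lam mu (k - (r + 1)) 1 := by
  rcases lt_or_ge k 0 with hk | hk
  · rw [vacuumCoeff_one_neg _ _ _ hk, vacuumCoeff_one_neg _ _ _ (by omega)]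
    simp
  obtain ⟨n, rfl⟩ := Int.eq_ofNat_of_zero_le hk
  induction n using Nat.strong_induction_on with
  | _ n ih =>
  rcases Nat.eq_zero_or_pos n with rfl | hn
  · rw [Nat.cast_zero, vacuumCoeff_zero_one, vacuumCoeff_one_neg _ _ _ (by omega), heis_succ]
    simp
  have hn0 : ((n : ℤ) : ℂ) ≠ 0 := by exact_mod_cast hn.ne'
  refine smul_right_injective _ hn0 ?_
  beta_reduce
  have hev := (vacuumCoeff_evZero lam mu (n - 1) 1).mul_left fun t => X t
  have hev' := (vacuumCoeff_evZero lam mu ((n - (r + 1) : ℤ) - 1) 1).mul_left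
    fun t => X t
  have hih : ∀ t : ℕ, heis nu ((r : ℤ) + 1) (vacuumCoeff lam mu (n - 1 - t) 1)
      = lam • vacuumCoeff lam mu (n - (r + 1) - 1 - t) 1 := by
    intro t
    rcases lt_or_ge ((n : ℤ) - 1 - t) 0 with ht | ht
    · rw [vacuumCoeff_one_neg _ _ _ ht, vacuumCoeff_one_neg _ _ _ (by omega)]
      simp
    · have := ih (n - 1 - t) (by omega) (by omega)
      rw [show ((n - 1 - t : ℕ) : ℤ) = (n : ℤ) - 1 - t by omega] at this
      rw [this]
      congr 2
      ring
  have h1 : ∀ t : ℕ, heis nu ((r : ℤ) + 1) (X t * vacuumCoeff lam mu (n - 1 - t) 1)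
      = lam • (X t * vacuumCoeff lam mu (n - (r + 1) - 1 - t) 1)
        + if t = r then ((r : ℂ) + 1) • vacuumCoeff lam mu (n - (r + 1)) 1 else 0 := by
    intro t
    rw [heis_X_mul, hih, mul_smul_comm]
    congr 1
    by_cases h : t = r
    · subst h
      rw [if_pos rfl, if_pos rfl, sub_sub, add_comm 1]
      push_cast
      rfl
    · rw [if_neg h, if_neg (by omega)]
  rw [← map_smul, mul_vacuumCoeff_one, map_smul, map_finsum_evZero hev]
  simp only [h1]
  rw [finsum_add_evZero (EvZero.smul hev' _), ← smul_finsum]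
  · rw [← mul_vacuumCoeff_one, finsum_eq_single _ r fun t ht => if_neg ht, if_pos rfl]
    push_cast
    module
  · exact ⟨r + 1, fun t ht => if_neg (by omega)⟩

/-- The commutator relation `[h(m), I(e^lam, z)] = lam z^m I(e^lam, z)`. -/
theorem heis_vacuumCoeff (m k : ℤ) (u : MvPolynomial ℕ ℂ) :
    heis (lam + mu) m (vacuumCoeff lam mu k u)
      = vacuumCoeff lam mu k (heis mu m u) + lam • vacuumCoeff lam mu (k - m) u := by
  rcases m with (_ | r) | i
  · rw [show Int.ofNat 0 = 0 from rfl, heis_zero, heis_zero, vacuumCoeff_smul, sub_zero]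
    module
  · rw [show Int.ofNat (r + 1) = (r : ℤ) + 1 from rfl]
    induction u using MvPolynomial.induction_on generalizing k with
    | C a =>
      rw [vacuumCoeff_C, vacuumCoeff_C, map_smul, heis_vacuumCoeff_one, heis_succ]
      simp [vacuumCoeff, smul_comm a]
    | add p q hp hq => simp only [vacuumCoeff_add, map_add, hp, hq, smul_add]; abel
    | mul_X p j hp =>
      rw [mul_comm, vacuumCoeff_X_mul, vacuumCoeff_X_mul, map_sub, map_smul, heis_X_mul,
        heis_X_mul, hp, hp, vacuumCoeff_add, vacuumCoeff_X_mul]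
      rw [show k + j + 1 - ((r : ℤ) + 1) = k - ((r : ℤ) + 1) + j + 1 by ring]
      split_ifs
      · rw [vacuumCoeff_smul, mul_add, mul_smul_comm]
        module
      · rw [show vacuumCoeff lam mu k 0 = 0 by simp [vacuumCoeff], mul_add, mul_smul_comm]
        module
  · rw [show Int.negSucc i = -(i : ℤ) - 1 by rw [Int.negSucc_eq]; ring, heis_neg, heis_neg,
      vacuumCoeff_X_mul, show k - (-(i : ℤ) - 1) = k + i + 1 by ring]
    abel

/-- The derivative `d/dz I(e^lam, z) = lam (h₋(z) I(e^lam, z) + I(e^lam, z) h₊(z))`. -/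
theorem mul_vacuumCoeff (k : ℤ) (u : MvPolynomial ℕ ℂ) :
    (lam * mu + k) • vacuumCoeff lam mu k u
      = lam • (∑ᶠ t : ℕ, X t * vacuumCoeff lam mu (k - 1 - t) u
        + ∑ᶠ r : ℕ, vacuumCoeff lam mu (k + r) (heis mu r u)) := by
  have ev1 : ∀ k u, EvZero fun t : ℕ => X t * vacuumCoeff lam mu (k - t) u := fun k u =>
    (vacuumCoeff_evZero lam mu k u).mul_left _
  have ev2 : ∀ k u, EvZero fun r : ℕ => vacuumCoeff lam mu (k + r) (heis mu r u) := by
    intro k u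
    obtain ⟨R, hR⟩ := (truncated_heis mu).nat u
    exact ⟨R, fun r hr => by simp [hR r hr, vacuumCoeff]⟩
  induction u using MvPolynomial.induction_on generalizing k with
  | C a =>
    have h : ∑ᶠ r : ℕ, vacuumCoeff lam mu (k + r) (heis mu r (C a))
        = mu • vacuumCoeff lam mu k (C a) := by
      rw [finsum_eq_single _ 0]
      · simp [vacuumCoeff_smul]
      · intro r hr
        obtain ⟨r, rfl⟩ := Nat.exists_eq_succ_of_ne_zero hr
        have : heis mu ((r + 1 : ℕ) : ℤ) (C a) = 0 := by
          push_cast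
          simp [heis_succ]
        rw [Nat.succ_eq_add_one, this]
        simp [vacuumCoeff]
    have h2 : lam • ∑ᶠ t : ℕ, X t * vacuumCoeff lam mu (k - 1 - t) (C a)
        = (k : ℂ) • vacuumCoeff lam mu k (C a) := by
      simp only [vacuumCoeff_C, mul_smul_comm]
      rw [← smul_finsum, smul_comm, ← mul_vacuumCoeff_one, smul_comm]
    rw [h, smul_add, h2]
    module
  | add p q hp hq =>
    simp only [vacuumCoeff_add, map_add, smul_add, hp, hq, mul_add]
    rw [finsum_add_evZero (ev1 _ _) (ev1 _ _), finsum_add_evZero (ev2 _ _) (ev2 _ _)]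
    module
  | mul_X p j hp =>
    rw [mul_comm p]
    have h1 : ∀ t : ℕ, X t * vacuumCoeff lam mu (k - 1 - t) (X j * p)
        = X j * (X t * vacuumCoeff lam mu (k - 1 - t) p)
          - lam • (X t * vacuumCoeff lam mu ((k + j + 1) - 1 - t) p) := by
      intro t
      rw [vacuumCoeff_X_mul, show k + j + 1 - 1 - (t : ℤ) = k - 1 - t + j + 1 by ring,
        mul_sub, mul_smul_comm]
      ring
    have h2 : ∀ r : ℕ, vacuumCoeff lam mu (k + r) (heis mu r (X j * p))
        = X j * vacuumCoeff lam mu (k + r) (heis mu r p)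
          - lam • vacuumCoeff lam mu ((k + j + 1) + r) (heis mu r p)
          + if r = j + 1 then ((j : ℂ) + 1) • vacuumCoeff lam mu (k + j + 1) p else 0 := by
      intro r
      rw [heis_X_mul, vacuumCoeff_add, vacuumCoeff_X_mul,
        show k + j + 1 + (r : ℤ) = k + r + j + 1 by ring]
      congr 1
      by_cases hr : r = j + 1
      · subst hr
        rw [if_pos (by simp), if_pos rfl, vacuumCoeff_smul]
        push_cast
        rw [add_assoc]
      · rw [if_neg hr, if_neg (by omega)]
        simp [vacuumCoeff]
    have evX1 := (ev1 (k - 1) p).mul_left fun _ => X j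
    have evX2 := (ev2 k p).mul_left fun _ => X j
    simp only [h1, h2]
    rw [finsum_sub_evZero evX1 ((ev1 _ _).smul _), finsum_add_evZero
      (EvZero.sub evX2 ((ev2 _ _).smul _))
      ⟨j + 2, fun r hr => if_neg (by omega)⟩, finsum_sub_evZero evX2 ((ev2 _ _).smul _),
      ← smul_finsum, ← smul_finsum,
      finsum_eq_single _ (j + 1) fun t ht => if_neg ht, if_pos rfl, vacuumCoeff_X_mul]
    rw [← mul_finsum_evZero (ev1 _ _), ← mul_finsum_evZero (ev2 _ _), smul_sub, ← mul_smul_comm,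
      hp k, smul_comm _ lam,
      show lam * mu + (k : ℂ) = (lam * mu + ((k + j + 1 : ℤ) : ℂ)) - ((j : ℂ) + 1) by
        push_cast; ring, sub_smul, hp (k + j + 1), mul_smul_comm, mul_add]
    module

end VacuumRelations

/-! ### Modes of `I(v, z)` and the commutator formula -/

section Modes

open MvPolynomial

variable (lam mu : ℂ)

theorem latticeVertexOperator_apply (v : M1 lam) (u : M1 mu) {n : ℂ} {k : ℤ}
    (hk : lam * mu + k = -n - 1) :
    latticeVertexOperator lam mu v n u = (latticeSeries lam mu v u).coeff k := by
  classical
  have h : ∃ k : ℤ, lam * mu + k = -n - 1 := ⟨k, hk⟩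
  have hc : h.choose = k := by
    have := h.choose_spec.trans hk.symm
    exact_mod_cast add_left_cancel this
  change (if hk : ∃ k : ℤ, lam * mu + k = -n - 1 then
      coeffLin (lam + mu) hk.choose ∘ₗ latticeSeries lam mu v else 0) u = _
  rw [dif_pos h, hc]
  rfl

theorem latticeVertexOperator_eq_zero (v : M1 lam) (u : M1 mu) {n : ℂ}
    (hn : ¬ ∃ k : ℤ, lam * mu + k = -n - 1) : latticeVertexOperator lam mu v n u = 0 := by
  classical
  change (if hk : ∃ k : ℤ, lam * mu + k = -n - 1 then
      coeffLin (lam + mu) hk.choose ∘ₗ latticeSeries lam mu v else 0) u = _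
  rw [dif_neg hn]
  rfl

/-- Shifting the index by an integer does not change whether it is an exponent of
`I_{lam,mu}(v, z)`. -/
theorem not_exists_exponent {n : ℂ} (hn : ¬ ∃ k : ℤ, lam * mu + k = -n - 1) (n' : ℂ) (d : ℤ)
    (h : n' = n + d) : ¬ ∃ k : ℤ, lam * mu + k = -n' - 1 := by
  rintro ⟨k, hk⟩
  refine hn ⟨k + d, ?_⟩
  push_cast
  rw [← add_assoc, hk, h]
  ring

theorem truncatedOp_latticeVertexOperator : TruncatedOp (latticeVertexOperator lam mu) := by
  intro v u n
  by_cases hn : ∃ k : ℤ, lam * mu + k = -n - 1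
  · obtain ⟨k, hk⟩ := hn
    obtain ⟨B, hB⟩ := evZero_coeff (lam + mu) (latticeSeries lam mu v u) k
    refine ⟨B, fun i hi => ?_⟩
    beta_reduce
    rw [latticeVertexOperator_apply lam mu v u (k := k - i) (by push_cast; linear_combination hk)]
    exact hB i hi
  · exact ⟨0, fun i _ => latticeVertexOperator_eq_zero lam mu v u
      (not_exists_exponent lam mu hn _ i (by simp))⟩

/-- `I(h(-j-1)v, z) = :∂^{(j)}h(z) I(v, z):` in modes. -/
theorem latticeVertexOperator_X_mul (j : ℕ) (v : M1 lam) (q : ℂ) (u : M1 mu) :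
    latticeVertexOperator lam mu (X j * v) q u
      = ∑ᶠ t : ℕ, ((t + j).choose j : ℂ) •
          (X (t + j) * latticeVertexOperator lam mu v (q + t) u)
        + ∑ᶠ r : ℕ, binom (-(r : ℤ) - 1) j •
          latticeVertexOperator lam mu v (q - r - j - 1) (heis mu r u) := by
  by_cases hq : ∃ k : ℤ, lam * mu + k = -q - 1
  · obtain ⟨k, hk⟩ := hq
    rw [latticeVertexOperator_apply lam mu _ u hk, latticeSeries_X_mul_coeff]
    congr 1
    · refine finsum_congr fun t => ?_
      rw [latticeVertexOperator_apply lam mu v u (k := k - t)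
        (by push_cast; linear_combination hk)]
    · refine finsum_congr fun r => ?_
      rw [latticeVertexOperator_apply lam mu v _ (k := k + r + j + 1)
        (by push_cast; linear_combination hk)]
  · rw [latticeVertexOperator_eq_zero lam mu _ u hq, finsum_eq_zero_of_forall_eq_zero,
      finsum_eq_zero_of_forall_eq_zero, add_zero]
    · intro r
      rw [latticeVertexOperator_eq_zero lam mu v _ (not_exists_exponent lam mu hq _ (-r - j - 1)
        (by push_cast; ring)), smul_zero]
    · intro t
      rw [latticeVertexOperator_eq_zero lam mu v _ (not_exists_exponent lam mu hq _ t
        (by push_cast; ring)), mul_zero, smul_zero]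

theorem isCreative_latticeVertexOperator :
    IsCreative (heis lam) (heis mu) (heis (lam + mu)) (latticeVertexOperator lam mu) := by
  intro k v q u
  rw [heis_neg, latticeVertexOperator_X_mul]
  simp only [heis_neg]

/-- `[h(m), I(e^lam, z)] = lam z^m I(e^lam, z)`. -/
theorem heis_latticeVertexOperator_one (m : ℤ) (q : ℂ) (u : M1 mu) :
    heis (lam + mu) m (latticeVertexOperator lam mu 1 q u)
      = latticeVertexOperator lam mu 1 q (heis mu m u)
        + lam • latticeVertexOperator lam mu 1 (q + m) u := by
  by_cases hq : ∃ k : ℤ, lam * mu + k = -q - 1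
  · obtain ⟨k, hk⟩ := hq
    rw [latticeVertexOperator_apply lam mu 1 u hk,
      latticeVertexOperator_apply lam mu 1 (heis mu m u) hk,
      latticeVertexOperator_apply lam mu 1 u (k := k - m) (by push_cast; linear_combination hk)]
    exact heis_vacuumCoeff lam mu m k u
  · rw [latticeVertexOperator_eq_zero lam mu 1 u hq,
      latticeVertexOperator_eq_zero lam mu 1 (heis mu m u) hq,
      latticeVertexOperator_eq_zero lam mu 1 _ (not_exists_exponent lam mu hq _ m rfl)]
    simp

/-- `d/dz I(e^lam, z) = lam :h(z) I(e^lam, z):`. -/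
theorem neg_smul_latticeVertexOperator_one (q : ℂ) (u : M1 mu) :
    (-q) • latticeVertexOperator lam mu 1 (q - 1) u
      = lam • (∑ᶠ t : ℕ, X t * latticeVertexOperator lam mu 1 (q + t) u
        + ∑ᶠ r : ℕ, latticeVertexOperator lam mu 1 (q - r - 1) (heis mu r u)) := by
  by_cases hq : ∃ k : ℤ, lam * mu + k = -q - 1
  · obtain ⟨k, hk⟩ := hq
    rw [latticeVertexOperator_apply lam mu 1 u (k := k + 1)
      (by push_cast; linear_combination hk),
      show -q = lam * mu + ((k + 1 : ℤ) : ℂ) by push_cast; linear_combination -hk]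
    refine (mul_vacuumCoeff lam mu (k + 1) u).trans ?_
    congr 2
    · refine finsum_congr fun t => ?_
      rw [latticeVertexOperator_apply lam mu 1 u (k := k + 1 - 1 - t)
        (by push_cast; linear_combination hk)]
      rfl
    · refine finsum_congr fun r => ?_
      rw [latticeVertexOperator_apply lam mu 1 _ (k := k + 1 + r)
        (by push_cast; linear_combination hk)]
      rfl
  · rw [latticeVertexOperator_eq_zero lam mu 1 u (not_exists_exponent lam mu hq _ (-1)
      (by push_cast; ring)), finsum_eq_zero_of_forall_eq_zero, finsum_eq_zero_of_forall_eq_zero]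
    · simp
    · intro r
      rw [latticeVertexOperator_eq_zero lam mu 1 _ (not_exists_exponent lam mu hq _ (-r - 1)
        (by push_cast; ring))]
    · intro t
      rw [latticeVertexOperator_eq_zero lam mu 1 _ (not_exists_exponent lam mu hq _ t
        (by push_cast; ring)), mul_zero]

theorem heis_comm (m : ℤ) (r : ℕ) (u : MvPolynomial ℕ ℂ) :
    heis mu m (heis mu r u)
      = heis mu r (heis mu m u) + if (r : ℤ) = -m then (m : ℂ) • u else 0 := by
  rcases lt_or_ge m 0 with hm | hm
  · obtain ⟨k, rfl⟩ : ∃ k : ℕ, m = -(k : ℤ) - 1 := ⟨(-m - 1).toNat, by omega⟩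
    rw [heis_neg, heis_neg, heis_X_mul]
    by_cases h : r = k + 1
    · subst h
      rw [if_pos (by push_cast; ring), if_pos (by push_cast; ring)]
      push_cast
      module
    · rw [if_neg (by omega), if_neg (by omega)]
      simp
  · have h0 : (if (r : ℤ) = -m then (m : ℂ) • u else 0) = 0 := by
      split_ifs with h
      · obtain rfl : m = 0 := by omega
        simp
      · rfl
    obtain ⟨n, rfl⟩ := Int.eq_ofNat_of_zero_le hm
    rw [h0, add_zero]
    clear h0 hm
    induction u using MvPolynomial.induction_on with
    | C a =>
      rcases r with _ | r <;> rcases n with _ | n <;> simp [heis_succ]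
    | add p q hp hq => simp [hp, hq]
    | mul_X p j hp =>
      rw [mul_comm]
      simp only [heis_X_mul, map_add, hp]
      split_ifs <;> (simp; try abel)

theorem mul_binom_sub_one (m : ℤ) (j : ℕ) :
    (m : ℂ) * binom (m - 1) j = ((j : ℂ) + 1) * binom m (j + 1) := by
  have := choose_mul_binom m j 1
  rw [Nat.choose_one_right, Nat.cast_one] at this
  have h1 : binom m 1 = m := by simp [binom]
  rw [h1] at this
  rw [← this]
  push_cast
  ring

/-- The contributions of `[h(m), h(-t-j-1)]` and `[h(m), h(r)]` to `[h(m), :∂^{(j)}h(z) F(z):]`,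
where `F(z) = ∑ f_n z^{-n-1}`: only one of the two sums can be nonzero. -/
theorem finsum_heis_commutator {M : Type*} [AddCommGroup M] [Module ℂ M] (f : ℂ → M) (m : ℤ)
    (j : ℕ) (q : ℂ) :
    (∑ᶠ t : ℕ, if m = ((t + j : ℕ) : ℤ) + 1 then (((t + j).choose j : ℂ) * m) • f (q + t) else 0)
      + ∑ᶠ r : ℕ, (if (r : ℤ) = -m then (binom (-(r : ℤ) - 1) j * m) • f (q - r - j - 1) else 0)
    = (binom m (j + 1) * (j + 1)) • f (q + m - j - 1) := by
  rw [mul_comm (binom m (j + 1)), ← mul_binom_sub_one]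
  rcases le_or_gt m 0 with hm | hm
  · obtain ⟨r, hr⟩ := Int.eq_ofNat_of_zero_le (neg_nonneg.mpr hm)
    obtain rfl : m = -(r : ℤ) := by omega
    rw [finsum_eq_zero_of_forall_eq_zero fun t => if_neg (by omega), zero_add,
      finsum_eq_single _ r fun t ht => if_neg (by omega), if_pos (by omega), mul_comm (binom _ _)]
    push_cast
    rw [← sub_eq_add_neg]
  · rw [finsum_eq_zero_of_forall_eq_zero (f := fun r : ℕ => if (r : ℤ) = -m then _ else (0 : M))
      fun r => if_neg (by omega), add_zero]
    obtain ⟨n, rfl⟩ : ∃ n : ℕ, m = n + 1 := ⟨(m - 1).toNat, by omega⟩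
    rw [add_sub_cancel_right, binom_natCast]
    by_cases hj : j ≤ n
    · obtain ⟨t, rfl⟩ := Nat.exists_eq_add_of_le' hj
      rw [finsum_eq_single _ t fun i hi => if_neg (by omega), if_pos rfl, mul_comm]
      congr 2
      push_cast
      ring
    · rw [finsum_eq_zero_of_forall_eq_zero fun t => if_neg (by omega),
        Nat.choose_eq_zero_of_lt (not_le.mp hj)]
      simp

/-- The commutator formula `[h(m), I(v, z)] = ∑ₛ C(m, s) z^{m-s} I(h(s)v, z)`. -/
theorem hasCommutatorFormula_latticeVertexOperator :
    HasCommutatorFormula (heis lam) (heis mu) (heis (lam + mu)) (latticeVertexOperator lam mu) := by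
  intro m v
  set I := latticeVertexOperator lam mu with hI
  have ev : ∀ (w : MvPolynomial ℕ ℂ) (q : ℂ) (u : MvPolynomial ℕ ℂ), EvZero fun s : ℕ =>
      binom m s • I (heis lam s w) (q + m - s) u := by
    intro w q u
    obtain ⟨S, hS⟩ := (truncated_heis lam).nat w
    exact ⟨S, fun s hs => by simp [hS s hs]⟩
  induction v using MvPolynomial.induction_on with
  | C a =>
    intro q u
    have h1 : I (C a) = a • I 1 := by rw [← map_smul, smul_eq_C_mul, mul_one]
    rw [h1, finsum_eq_single _ 0]
    · simp only [Pi.smul_apply, LinearMap.smul_apply, map_smul, hI, heis_latticeVertexOperator_one]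
      rw [Nat.cast_zero, heis_zero, map_smul, ← hI, h1, binom_zero_right, Nat.cast_zero, sub_zero]
      simp only [Pi.smul_apply, LinearMap.smul_apply]
      module
    · intro s hs
      obtain ⟨s, rfl⟩ := Nat.exists_eq_succ_of_ne_zero hs
      have : heis lam ((s + 1 : ℕ) : ℤ) (C a) = 0 := by
        push_cast
        simp [heis_succ]
      rw [Nat.succ_eq_add_one, this]
      simp
  | add p p' hp hp' =>
    intro q u
    simp only [map_add, Pi.add_apply, LinearMap.add_apply, smul_add, hp, hp']
    rw [finsum_add_evZero (ev _ _ _) (ev _ _ _)]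
    abel
  | mul_X v j hv =>
    intro q u
    rw [mul_comm v]
    have hT := truncatedOp_latticeVertexOperator lam mu
    rw [← hI] at hT
    obtain ⟨S, hS⟩ := (truncated_heis lam).nat v
    have hS' : ∀ s, max S (j + 2) ≤ s → heis lam (s : ℤ) (X j * v) = 0 := fun s hs => by
      rw [heis_X_mul, if_neg (by omega)]
      simp [hS s (le_of_max_le_left hs)]
    have hv' : ∀ (q : ℂ) (u : MvPolynomial ℕ ℂ), heis (lam + mu) m (I v q u) = I v q (heis mu m u)
        + ∑ s ∈ Finset.range (max S (j + 2)), binom m s • I (heis lam s v) (q + m - s) u := by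
      intro q u
      rw [hv, finsum_eq_sum_range (B := max S (j + 2)) fun s hs => by
        simp [hS s (le_of_max_le_left hs)]]
    -- commuting `h(m)` with the creation part of `:∂^{(j)}h(z) I(v, z):`
    have h1 : ∀ t : ℕ, heis (lam + mu) m (((t + j).choose j : ℂ) • (X (t + j) * I v (q + t) u))
        = ((t + j).choose j : ℂ) • (X (t + j) * I v (q + t) (heis mu m u))
          + (if m = ((t + j : ℕ) : ℤ) + 1 then (((t + j).choose j : ℂ) * m) • I v (q + t) u else 0)
          + ∑ s ∈ Finset.range (max S (j + 2)), binom m s • ((t + j).choose j : ℂ) •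
            (X (t + j) * I (heis lam s v) (q + m - s + t) u) := by
      intro t
      rw [map_smul, heis_X_mul, hv', mul_add, smul_add, smul_add, add_right_comm, Finset.mul_sum,
        Finset.smul_sum]
      congr 1
      · congr 1
        rw [smul_ite, smul_smul, smul_zero]
      · refine Finset.sum_congr rfl fun s _ => ?_
        rw [mul_smul_comm, smul_comm, show q + t + m - s = q + m - s + t by ring]
    -- commuting `h(m)` with its annihilation part
    have h2 : ∀ r : ℕ,
        heis (lam + mu) m (binom (-(r : ℤ) - 1) j • I v (q - r - j - 1) (heis mu r u))
        = binom (-(r : ℤ) - 1) j • I v (q - r - j - 1) (heis mu r (heis mu m u))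
          + (if (r : ℤ) = -m then (binom (-(r : ℤ) - 1) j * m) • I v (q - r - j - 1) u else 0)
          + ∑ s ∈ Finset.range (max S (j + 2)), binom m s • binom (-(r : ℤ) - 1) j •
            I (heis lam s v) (q + m - s - r - j - 1) (heis mu r u) := by
      intro r
      rw [map_smul, hv', heis_comm, map_add, smul_add, smul_add, Finset.smul_sum]
      congr 1
      · congr 1
        split_ifs
        · rw [map_smul, smul_smul]
        · simp
      · refine Finset.sum_congr rfl fun s _ => ?_
        rw [smul_comm, show q - r - j - 1 + m - s = q + m - s - r - j - 1 by ring]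
    have e1 : ∀ (w : MvPolynomial ℕ ℂ) (q : ℂ) (u : MvPolynomial ℕ ℂ), EvZero fun t : ℕ =>
        ((t + j).choose j : ℂ) • (X (t + j) * I w (q + t) u) := fun w q u =>
      ((hT w u q).mul_left _).smul _
    have e2 : ∀ (w : MvPolynomial ℕ ℂ) (q : ℂ) (u : MvPolynomial ℕ ℂ), EvZero fun r : ℕ =>
        binom (-(r : ℤ) - 1) j • I w (q - r - j - 1) (heis mu r u) := fun w q u =>
      (((truncated_heis mu).nat u).map fun r : ℕ => I w (q - r - j - 1)).smul _
    have e3 : EvZero fun t : ℕ => if m = ((t + j : ℕ) : ℤ) + 1 then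
        (((t + j).choose j : ℂ) * m) • I v (q + t) u else 0 :=
      ⟨m.toNat + 1, fun t ht => if_neg (by omega)⟩
    have e4 : EvZero fun r : ℕ => if (r : ℤ) = -m then
        (binom (-(r : ℤ) - 1) j * m) • I v (q - r - j - 1) u else 0 :=
      ⟨(-m).toNat + 1, fun t ht => if_neg (by omega)⟩
    -- the extra term, present only for `s = j + 1`, comes from `[h(s), h(-j-1)]`
    have h3 : ∀ s : ℕ, binom m s • I (heis lam s (X j * v)) (q + m - s) u
        = binom m s • (∑ᶠ t : ℕ, ((t + j).choose j : ℂ) •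
            (X (t + j) * I (heis lam s v) (q + m - s + t) u))
          + binom m s • (∑ᶠ r : ℕ, binom (-(r : ℤ) - 1) j •
            I (heis lam s v) (q + m - s - r - j - 1) (heis mu r u))
          + if s = j + 1 then (binom m (j + 1) * (j + 1)) • I v (q + m - j - 1) u else 0 := by
      intro s
      rw [heis_X_mul, map_add, Pi.add_apply, LinearMap.add_apply, hI, latticeVertexOperator_X_mul,
        smul_add, smul_add]
      congr 1
      by_cases hs : s = j + 1
      · subst hs
        rw [if_pos (by push_cast; ring), if_pos rfl, map_smul, Pi.smul_apply,
          LinearMap.smul_apply, smul_smul]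
        push_cast
        rw [sub_sub]
      · rw [if_neg (by omega), if_neg hs]
        simp
    rw [finsum_eq_sum_range (B := max S (j + 2)) fun s hs => by simp [hS' s hs],
      Finset.sum_congr rfl fun s _ => h3 s, Finset.sum_add_distrib, Finset.sum_add_distrib,
      Finset.sum_ite_eq', if_pos (by simp), ← finsum_heis_commutator (fun q => I v q u) m j q]
    rw [hI, latticeVertexOperator_X_mul, latticeVertexOperator_X_mul, ← hI, map_add,
      map_finsum_evZero (e1 _ _ _), map_finsum_evZero (e2 _ _ _)]
    simp only [h1, h2]
    rw [finsum_add_evZero ((e1 _ _ _).add e3) (evZero_sum fun s _ => (e1 _ _ _).smul _),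
      finsum_add_evZero (e1 _ _ _) e3,
      finsum_add_evZero ((e2 _ _ _).add e4) (evZero_sum fun s _ => (e2 _ _ _).smul _),
      finsum_add_evZero (e2 _ _ _) e4,
      finsum_sum_comm _ _ fun s _ => ((e1 _ _ _).smul _).hasFiniteSupport,
      finsum_sum_comm _ _ fun s _ => ((e2 _ _ _).smul _).hasFiniteSupport]
    simp only [smul_finsum]
    abel

end Modes

/-! ### The Jacobi identity -/

section Jacobi

open MvPolynomial

variable (lam mu : ℂ)

/-- The modes of the vertex operator of an arbitrary `a ∈ M(1)` on `M(1, mu)`. -/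
noncomputable def fockMode (a : MvPolynomial ℕ ℂ) (n : ℤ) : Module.End ℂ (MvPolynomial ℕ ℂ) :=
  latticeVertexOperator 0 mu a n

/-- `I(1, z)` is the identity. -/
theorem vacuumCoeff_zero_left (k : ℤ) (u : MvPolynomial ℕ ℂ) :
    vacuumCoeff 0 mu k u = if k = 0 then u else 0 := by
  induction u using MvPolynomial.induction_on with
  | C a =>
    rw [vacuumCoeff_C]
    by_cases hk : k = 0
    · subst hk
      rw [vacuumCoeff_zero_one, if_pos rfl, smul_eq_C_mul, mul_one]
    · have h := mul_vacuumCoeff_one 0 mu k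
      rw [zero_smul, smul_eq_zero] at h
      rw [if_neg hk, h.resolve_left (by exact_mod_cast hk), smul_zero]
  | add p q hp hq =>
    rw [vacuumCoeff_add, hp, hq]
    split_ifs <;> simp
  | mul_X p j hp =>
    rw [mul_comm, vacuumCoeff_X_mul, hp, zero_smul, sub_zero]
    split_ifs <;> simp

theorem fockMode_one (n : ℤ) (u : MvPolynomial ℕ ℂ) :
    fockMode mu 1 n u = if n = -1 then u else 0 := by
  rw [fockMode, latticeVertexOperator_apply 0 mu 1 u (k := -n - 1) (by push_cast; ring)]
  refine (vacuumCoeff_zero_left mu (-n - 1) u).trans ?_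
  by_cases h : n = -1
  · rw [if_pos h, if_pos (by omega)]
  · rw [if_neg h, if_neg (by omega)]

theorem fockMode_add (a b : MvPolynomial ℕ ℂ) (n : ℤ) :
    fockMode mu (a + b) n = fockMode mu a n + fockMode mu b n := by
  simp [fockMode]

theorem fockMode_smul (c : ℂ) (a : MvPolynomial ℕ ℂ) (n : ℤ) :
    fockMode mu (c • a) n = c • fockMode mu a n := by
  simp [fockMode]

theorem truncated_fockMode (a : MvPolynomial ℕ ℂ) : Truncated (fockMode mu a) := by
  intro w m
  have := truncatedOp_latticeVertexOperator 0 mu a w m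
  simpa [fockMode] using this

theorem fockMode_X_mul (j : ℕ) (b : MvPolynomial ℕ ℂ) (p : ℤ) (w : MvPolynomial ℕ ℂ) :
    fockMode mu (X j * b) p w
      = ∑ᶠ t : ℕ, ((t + j).choose j : ℂ) • (X (t + j) * fockMode mu b (p + t) w)
        + ∑ᶠ r : ℕ, binom (-(r : ℤ) - 1) j • fockMode mu b (p - r - j - 1) (heis mu r w) := by
  refine (latticeVertexOperator_X_mul 0 mu j b p w).trans ?_
  simp only [fockMode, Int.cast_add, Int.cast_sub, Int.cast_natCast, Int.cast_one]

theorem isNormalProduct_fockMode (j : ℕ) (b : MvPolynomial ℕ ℂ) :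
    IsNormalProduct (heis mu) j (fockMode mu b) (fockMode mu (X j * b)) := by
  intro p w
  rw [fockMode_X_mul]
  simp only [heis_neg]

theorem sum_delta_left (f : ℂ → MvPolynomial ℕ ℂ) (l m : ℤ) (n : ℂ) :
    ∑ᶠ i : ℕ, ((-1) ^ i * binom l i) • (if m + l - i = -1 then f (n + i) else 0)
      = (if 0 ≤ m + l + 1 then (-1) ^ (m + l + 1).toNat * binom l (m + l + 1).toNat else 0) •
        f (n + m + l + 1) := by
  split_ifs with h
  · rw [finsum_eq_single _ (m + l + 1).toNat fun i hi => by rw [if_neg (by omega), smul_zero],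
      if_pos (by omega)]
    have : (((m + l + 1).toNat : ℤ) : ℂ) = m + l + 1 := by
      rw [Int.toNat_of_nonneg h]; push_cast; ring
    rw [Int.cast_natCast] at this
    rw [this]
    congr 2
    ring
  · rw [zero_smul]
    exact finsum_eq_zero_of_forall_eq_zero fun i => by rw [if_neg (by omega), smul_zero]

theorem sum_delta_right (f : ℂ → MvPolynomial ℕ ℂ) (l m : ℤ) (n : ℂ) :
    ∑ᶠ i : ℕ, ((-1) ^ l * (-1) ^ i * binom l i) • (if m + i = -1 then f (n + l - i) else 0)
      = (if m ≤ -1 then (-1) ^ l * (-1) ^ (-m - 1).toNat * binom l (-m - 1).toNat else 0) •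
        f (n + m + l + 1) := by
  split_ifs with h
  · rw [finsum_eq_single _ (-m - 1).toNat fun i hi => by rw [if_neg (by omega), smul_zero],
      if_pos (by omega)]
    have : (((-m - 1).toNat : ℤ) : ℂ) = -m - 1 := by
      rw [Int.toNat_of_nonneg (by omega)]; push_cast; ring
    rw [Int.cast_natCast] at this
    rw [this]
    congr 2
    ring
  · rw [zero_smul]
    exact finsum_eq_zero_of_forall_eq_zero fun i => by rw [if_neg (by omega), smul_zero]

theorem sum_delta_iterate (f : ℂ → MvPolynomial ℕ ℂ) (l m : ℤ) (n : ℂ) :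
    ∑ᶠ i : ℕ, binom m i • (if l + i = -1 then f (m + n - i) else 0)
      = (if l ≤ -1 then binom m (-l - 1).toNat else 0) • f (n + m + l + 1) := by
  split_ifs with h
  · rw [finsum_eq_single _ (-l - 1).toNat fun i hi => by rw [if_neg (by omega), smul_zero],
      if_pos (by omega)]
    have : (((-l - 1).toNat : ℤ) : ℂ) = -l - 1 := by
      rw [Int.toNat_of_nonneg (by omega)]; push_cast; ring
    rw [Int.cast_natCast] at this
    rw [this]
    congr 2
    ring
  · rw [zero_smul]
    exact finsum_eq_zero_of_forall_eq_zero fun i => by rw [if_neg (by omega), smul_zero]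

/-- The identity `z₀⁻¹ δ((z₁-z₂)/z₀) - z₀⁻¹ δ((z₂-z₁)/(-z₀)) = z₂⁻¹ δ((z₁-z₀)/z₂)` of formal delta
functions, in coefficients. -/
theorem delta_identity (l m : ℤ) :
    (if 0 ≤ m + l + 1 then (-1) ^ (m + l + 1).toNat * binom l (m + l + 1).toNat else 0)
      - (if m ≤ -1 then (-1) ^ l * (-1) ^ (-m - 1).toNat * binom l (-m - 1).toNat else 0)
    = if l ≤ -1 then binom m (-l - 1).toNat else 0 := by
  have hsq : ∀ k : ℕ, ((-1 : ℂ) ^ k) * (-1) ^ k = 1 := fun k => by rw [← mul_pow]; simp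
  rcases lt_or_ge l 0 with hl | hl <;> rcases lt_or_ge m 0 with hm | hm
  · obtain ⟨k, rfl⟩ : ∃ k : ℕ, l = -(k : ℤ) - 1 := ⟨(-l - 1).toNat, by omega⟩
    obtain ⟨i, rfl⟩ : ∃ i : ℕ, m = -(i : ℤ) - 1 := ⟨(-m - 1).toNat, by omega⟩
    rw [if_neg (by omega), if_pos (by omega), if_pos (by omega),
      show (-(-(i : ℤ) - 1) - 1).toNat = i by omega, show (-(-(k : ℤ) - 1) - 1).toNat = k by omega,
      binom_neg_succ, binom_neg_succ, zpow_sub₀ (by norm_num), zpow_neg, zpow_natCast, zpow_one,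
      add_comm i k, Nat.choose_symm_add, ← inv_pow]
    norm_num
    linear_combination ((-1) ^ k * ((k + i).choose i : ℂ)) * hsq i
  · obtain ⟨k, rfl⟩ : ∃ k : ℕ, l = -(k : ℤ) - 1 := ⟨(-l - 1).toNat, by omega⟩
    obtain ⟨i, rfl⟩ := Int.eq_ofNat_of_zero_le hm
    rw [if_neg (by omega : ¬ (i : ℤ) ≤ -1), if_pos (by omega : -(k : ℤ) - 1 ≤ -1),
      show (-(-(k : ℤ) - 1) - 1).toNat = k by omega, binom_natCast, sub_zero]
    by_cases hk : k ≤ i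
    · obtain ⟨p, rfl⟩ := Nat.exists_eq_add_of_le hk
      rw [if_pos (by omega), show (((k + p : ℕ) : ℤ) + (-(k : ℤ) - 1) + 1).toNat = p by omega,
        binom_neg_succ, ← mul_assoc, hsq, one_mul, Nat.choose_symm_add]
    · rw [if_neg (by omega), Nat.choose_eq_zero_of_lt (not_le.mp hk), Nat.cast_zero]
  · obtain ⟨k, rfl⟩ := Int.eq_ofNat_of_zero_le hl
    obtain ⟨i, rfl⟩ : ∃ i : ℕ, m = -(i : ℤ) - 1 := ⟨(-m - 1).toNat, by omega⟩
    rw [if_pos (by omega : -(i : ℤ) - 1 ≤ -1), if_neg (by omega : ¬ (k : ℤ) ≤ -1),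
      show (-(-(i : ℤ) - 1) - 1).toNat = i by omega, binom_natCast, binom_natCast, zpow_natCast]
    by_cases hk : i ≤ k
    · obtain ⟨p, rfl⟩ := Nat.exists_eq_add_of_le hk
      rw [if_pos (by omega), show (-(i : ℤ) - 1 + ((i + p : ℕ) : ℤ) + 1).toNat = p by omega,
        Nat.choose_symm_add, pow_add]
      linear_combination (-(-1) ^ p * ((i + p).choose p : ℂ)) * hsq i
    · rw [if_neg (by omega), Nat.choose_eq_zero_of_lt (not_le.mp hk)]
      simp
  · obtain ⟨k, rfl⟩ := Int.eq_ofNat_of_zero_le hl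
    obtain ⟨i, rfl⟩ := Int.eq_ofNat_of_zero_le hm
    rw [if_pos (by omega), if_neg (by omega), if_neg (by omega), binom_natCast,
      Nat.choose_eq_zero_of_lt (by omega)]
    simp

/-- The Jacobi identity for all of `M(1)`, by induction on `a`. -/
theorem jacobi_latticeVertexOperator (a : MvPolynomial ℕ ℂ) :
    ∀ (l m : ℤ) (n : ℂ) (v u : MvPolynomial ℕ ℂ),
      jacobiLeft (fockMode (lam + mu) a) (latticeVertexOperator lam mu) l m n v u
        - jacobiRight (fockMode mu a) (latticeVertexOperator lam mu) l m n v u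
        = jacobiIterate (fockMode lam a) (latticeVertexOperator lam mu) l m n v u := by
  have hT := truncatedOp_latticeVertexOperator lam mu
  induction a using MvPolynomial.induction_on with
  | C c =>
    intro l m n v u
    have hL : jacobiLeft (fockMode (lam + mu) 1) (latticeVertexOperator lam mu) l m n v u
        - jacobiRight (fockMode mu 1) (latticeVertexOperator lam mu) l m n v u
        = jacobiIterate (fockMode lam 1) (latticeVertexOperator lam mu) l m n v u := by
      simp only [jacobiLeft, jacobiRight, jacobiIterate, fockMode_one]
      rw [sum_delta_left (fun q => latticeVertexOperator lam mu v q u)]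
      have h2 : ∀ i : ℕ, latticeVertexOperator lam mu v (n + l - i) (if m + i = -1 then u else 0)
          = if m + i = -1 then latticeVertexOperator lam mu v (n + l - i) u else 0 := by
        intro i
        split_ifs <;> simp
      have h3 : ∀ i : ℕ, latticeVertexOperator lam mu (if l + i = -1 then v else 0) (m + n - i) u
          = if l + i = -1 then latticeVertexOperator lam mu v (m + n - i) u else 0 := by
        intro i
        split_ifs <;> simp
      simp only [h2, h3]
      rw [sum_delta_right (fun q => latticeVertexOperator lam mu v q u),
        sum_delta_iterate (fun q => latticeVertexOperator lam mu v q u), ← delta_identity, sub_smul]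
    have hc : (C c : MvPolynomial ℕ ℂ) = c • 1 := by rw [smul_eq_C_mul, mul_one]
    have hl : jacobiLeft (fockMode (lam + mu) (C c)) (latticeVertexOperator lam mu) l m n v u
        = c • jacobiLeft (fockMode (lam + mu) 1) (latticeVertexOperator lam mu) l m n v u := by
      simp only [jacobiLeft, hc, fockMode_smul, LinearMap.smul_apply, smul_finsum,
        smul_comm c]
    have hr : jacobiRight (fockMode mu (C c)) (latticeVertexOperator lam mu) l m n v u
        = c • jacobiRight (fockMode mu 1) (latticeVertexOperator lam mu) l m n v u := by
      simp only [jacobiRight, hc, fockMode_smul, LinearMap.smul_apply, smul_finsum,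
        smul_comm c, map_smul]
    have hi : jacobiIterate (fockMode lam (C c)) (latticeVertexOperator lam mu) l m n v u
        = c • jacobiIterate (fockMode lam 1) (latticeVertexOperator lam mu) l m n v u := by
      simp only [jacobiIterate, hc, fockMode_smul, LinearMap.smul_apply, smul_finsum,
        smul_comm c, map_smul, Pi.smul_apply]
    rw [hl, hr, hi, ← smul_sub, hL]
  | add p q hp hq =>
    intro l m n v u
    have hl : jacobiLeft (fockMode (lam + mu) (p + q)) (latticeVertexOperator lam mu) l m n v u
        = jacobiLeft (fockMode (lam + mu) p) (latticeVertexOperator lam mu) l m n v u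
          + jacobiLeft (fockMode (lam + mu) q) (latticeVertexOperator lam mu) l m n v u := by
      simp only [jacobiLeft, fockMode_add, LinearMap.add_apply, smul_add]
      exact finsum_add_evZero (evZero_left hT ..) (evZero_left hT ..)
    have hr : jacobiRight (fockMode mu (p + q)) (latticeVertexOperator lam mu) l m n v u
        = jacobiRight (fockMode mu p) (latticeVertexOperator lam mu) l m n v u
          + jacobiRight (fockMode mu q) (latticeVertexOperator lam mu) l m n v u := by
      simp only [jacobiRight, fockMode_add, LinearMap.add_apply, smul_add, map_add]
      exact finsum_add_evZero (evZero_right (truncated_fockMode mu p) ..)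
        (evZero_right (truncated_fockMode mu q) ..)
    have hi : jacobiIterate (fockMode lam (p + q)) (latticeVertexOperator lam mu) l m n v u
        = jacobiIterate (fockMode lam p) (latticeVertexOperator lam mu) l m n v u
          + jacobiIterate (fockMode lam q) (latticeVertexOperator lam mu) l m n v u := by
      simp only [jacobiIterate, fockMode_add, LinearMap.add_apply, smul_add, map_add, Pi.add_apply]
      exact finsum_add_evZero (evZero_iterate (truncated_fockMode lam p) ..)
        (evZero_iterate (truncated_fockMode lam q) ..)
    rw [hl, hr, hi, ← hp, ← hq]
    abel
  | mul_X b j hb =>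
    rw [mul_comm b]
    exact jacobi_step hT (truncated_fockMode lam b) (truncated_fockMode mu b)
      (truncated_fockMode (lam + mu) b) (truncated_heis lam) (truncated_heis mu)
      (isNormalProduct_fockMode lam j b) (isNormalProduct_fockMode mu j b)
      (isNormalProduct_fockMode (lam + mu) j b) (isCreative_latticeVertexOperator lam mu)
      (hasCommutatorFormula_latticeVertexOperator lam mu) hb

theorem jacobiIdentity_latticeVertexOperator :
    JacobiIdentity (moduleY lam) (moduleY mu) (moduleY (lam + mu))
      (latticeVertexOperator lam mu) := by
  intro a v u l m n
  have hT := truncatedOp_latticeVertexOperator lam mu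
  have h := jacobi_latticeVertexOperator lam mu (a : M1 0) l m n v u
  filter_upwards [finsum_eventually
      (evZero_left (Y₃ := fockMode (lam + mu) (a : M1 0)) hT l m n v u),
    finsum_eventually (evZero_right (I := latticeVertexOperator lam mu)
      (truncated_fockMode mu (a : M1 0)) l m n v u),
    finsum_eventually (evZero_iterate (I := latticeVertexOperator lam mu)
      (truncated_fockMode lam (a : M1 0)) l m n v u)] with N h1 h2 h3
  rw [jacobiLeft, jacobiRight, jacobiIterate, h1, h2, h3] at h
  exact h

end Jacobi

/-! ### The derivative property -/

section Translation

open MvPolynomial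

variable (lam mu : ℂ)

/-- `Y(h(-1)1, z) = h(z)`. -/
theorem fockMode_X_zero (p : ℤ) (w : MvPolynomial ℕ ℂ) : fockMode mu (X 0) p w = heis mu p w := by
  rw [← mul_one (X 0 : MvPolynomial ℕ ℂ), fockMode_X_mul]
  simp only [fockMode_one, add_zero, Nat.choose_zero_right, Nat.cast_one, binom_zero_right,
    one_smul, Nat.cast_zero, sub_zero]
  rcases lt_or_ge p 0 with hp | hp
  · obtain ⟨k, rfl⟩ : ∃ k : ℕ, p = -(k : ℤ) - 1 := ⟨(-p - 1).toNat, by omega⟩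
    rw [finsum_eq_single _ k fun i hi => by rw [if_neg (by omega), mul_zero], if_pos (by omega),
      finsum_eq_zero_of_forall_eq_zero fun r => by rw [if_neg (by omega)], add_zero, heis_neg]
  · obtain ⟨k, rfl⟩ := Int.eq_ofNat_of_zero_le hp
    rw [finsum_eq_zero_of_forall_eq_zero fun i => by rw [if_neg (by omega), mul_zero],
      finsum_eq_single _ k fun i hi => by rw [if_neg (by omega)], if_pos (by omega), zero_add]

theorem evZero_X_mul_heis (w : MvPolynomial ℕ ℂ) : EvZero fun t : ℕ => X t * heis mu t w :=
  ((truncated_heis mu).nat w).mul_left _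

/-- The Virasoro mode `L(-1) = ω_0` is `∑_{t ≥ 0} h(-t-1) h(t)`. -/
theorem moduleY_omega_zero (w : MvPolynomial ℕ ℂ) :
    moduleY mu omega 0 w = ∑ᶠ t : ℕ, X t * heis mu t w := by
  have h : moduleY mu omega 0 w = (1 / 2 : ℂ) • fockMode mu (X 0 * X 0) 0 w := by
    rw [← LinearMap.smul_apply, ← fockMode_smul, ← sq]
    rfl
  rw [h, fockMode_X_mul]
  simp only [fockMode_X_zero, add_zero, Nat.choose_zero_right, Nat.cast_one, binom_zero_right,
    one_smul, Nat.cast_zero, sub_zero, zero_add, zero_sub, heis_neg]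
  rw [← two_smul ℂ, smul_smul]
  norm_num

/-- `L(-1) e^mu = mu h(-1) e^mu`. -/
theorem moduleY_omega_zero_C (c : ℂ) :
    moduleY mu omega 0 (C c : MvPolynomial ℕ ℂ) = (c * mu) • (X 0 : MvPolynomial ℕ ℂ) := by
  rw [moduleY_omega_zero, finsum_eq_single _ 0]
  · simp [smul_eq_C_mul]
    ring
  · intro t ht
    obtain ⟨t, rfl⟩ := Nat.exists_eq_succ_of_ne_zero ht
    have : heis mu ((t + 1 : ℕ) : ℤ) (C c) = 0 := by
      push_cast
      simp [heis_succ]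
    rw [Nat.succ_eq_add_one, this, mul_zero]

/-- `[L(-1), h(-j-1)] = (j+1) h(-j-2)`. -/
theorem moduleY_omega_zero_X_mul (j : ℕ) (v : MvPolynomial ℕ ℂ) :
    moduleY mu omega 0 (X j * v : MvPolynomial ℕ ℂ)
      = X j * moduleY mu omega 0 v + ((j : ℂ) + 1) • (X (j + 1) * v) := by
  rw [moduleY_omega_zero, moduleY_omega_zero, mul_finsum_evZero (evZero_X_mul_heis mu v)]
  have h : ∀ t : ℕ, X t * heis mu t (X j * v) = X j * (X t * heis mu t v)
      + if t = j + 1 then ((j : ℂ) + 1) • (X (j + 1) * v) else 0 := by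
    intro t
    rw [heis_X_mul]
    by_cases ht : t = j + 1
    · subst ht
      rw [if_pos (by push_cast; ring), if_pos rfl, mul_add, mul_smul_comm]
      push_cast
      ring
    · rw [if_neg (by omega), if_neg ht]
      ring
  simp only [h]
  rw [finsum_add_evZero ((evZero_X_mul_heis mu v).mul_left _)
    ⟨j + 2, fun t ht => if_neg (by omega)⟩, finsum_eq_single _ (j + 1) fun t ht => if_neg ht,
    if_pos rfl]

theorem succ_mul_binom_succ (x : ℤ) (j : ℕ) :
    ((j : ℂ) + 1) * binom x (j + 1) = binom x j * (x - j) := by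
  have h := choose_mul_binom x 1 j
  have h1 : binom (x - j) 1 = x - j := by simp [binom]
  rw [h1, add_comm 1 j, Nat.choose_succ_self_right] at h
  rw [← h]
  push_cast
  ring

/-- `d/dz I(v, z) = I(L(-1)v, z)`, in modes. -/
theorem latticeVertexOperator_translation (v : MvPolynomial ℕ ℂ) :
    ∀ (q : ℂ) (u : MvPolynomial ℕ ℂ),
      latticeVertexOperator lam mu (moduleY lam omega 0 v) q u
        = (-q) • latticeVertexOperator lam mu v (q - 1) u := by
  set I := latticeVertexOperator lam mu with hI
  induction v using MvPolynomial.induction_on with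
  | C c =>
    intro q u
    have h1 : I (C c) = c • I 1 := by rw [← map_smul, smul_eq_C_mul, mul_one]
    rw [moduleY_omega_zero_C, map_smul, h1, Pi.smul_apply, LinearMap.smul_apply, Pi.smul_apply,
      LinearMap.smul_apply, smul_comm, hI, neg_smul_latticeVertexOperator_one, mul_smul]
    have h2 := latticeVertexOperator_X_mul lam mu 0 1 q u
    rw [mul_one] at h2
    rw [h2]
    simp [binom_zero_right]
  | add p p' hp hp' =>
    intro q u
    simp only [map_add, Pi.add_apply, LinearMap.add_apply, smul_add, hp, hp']
  | mul_X v j hv =>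
    intro q u
    have hT := truncatedOp_latticeVertexOperator lam mu
    rw [← hI] at hT
    have e1 : EvZero fun t : ℕ => ((t + j).choose j : ℂ) • (X (t + j) * I v (q - 1 + t) u) :=
      ((hT v u _).mul_left _).smul _
    have e2 : EvZero fun t : ℕ => (t : ℂ) • ((t + j).choose j : ℂ) •
        (X (t + j) * I v (q - 1 + t) u) := e1.smul _
    have e3 : EvZero fun r : ℕ => binom (-(r : ℤ) - 1) j • I v (q - 1 - r - j - 1) (heis mu r u) :=
      (((truncated_heis mu).nat u).map fun r : ℕ => I v (q - 1 - r - j - 1)).smul _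
    have e4 : EvZero fun r : ℕ => ((r : ℂ) + j + 1) • binom (-(r : ℤ) - 1) j •
        I v (q - 1 - r - j - 1) (heis mu r u) := e3.smul _
    -- the creation operators: the factor `q + t` produced by the derivative exceeds `q` by `t`,
    -- which is cancelled by `(t+1) C(t+1+j, j) = (j+1) C(t+j+1, j+1)` after a shift of `t`
    have c1 : ∀ t : ℕ, ((t + j).choose j : ℂ) • (X (t + j) * I (moduleY lam omega 0 v) (q + t) u)
        = (-q) • (((t + j).choose j : ℂ) • (X (t + j) * I v (q - 1 + t) u))
          - (t : ℂ) • ((t + j).choose j : ℂ) • (X (t + j) * I v (q - 1 + t) u) := by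
      intro t
      rw [hv, mul_smul_comm, show q + t - 1 = q - 1 + t by ring]
      module
    have c2 : ((j : ℂ) + 1) • ∑ᶠ t : ℕ, ((t + (j + 1)).choose (j + 1) : ℂ) •
          (X (t + (j + 1)) * I v (q + t) u)
        = ∑ᶠ t : ℕ, (t : ℂ) • ((t + j).choose j : ℂ) • (X (t + j) * I v (q - 1 + t) u) := by
      rw [finsum_eq_finsum_add (s := 1) (f := fun t : ℕ => (t : ℂ) • ((t + j).choose j : ℂ) •
        (X (t + j) * I v (q - 1 + t) u)) (fun r hr => by simp [Nat.lt_one_iff.mp hr]) e2,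
        smul_finsum]
      refine finsum_congr fun t => ?_
      have h := Nat.choose_mul_succ_eq (t + j) j
      have h' := Nat.add_one_mul_choose_eq (t + j) j
      have h2 : ((j : ℂ) + 1) * ((t + (j + 1)).choose (j + 1) : ℂ)
          = ((t + 1 : ℕ) : ℂ) * ((t + 1 + j).choose j : ℂ) := by
        rw [show t + 1 + j = t + j + 1 by ring, show t + (j + 1) = t + j + 1 by ring]
        rw [show t + j + 1 - j = t + 1 by omega] at h
        have := h'.symm.trans ((mul_comm _ _).trans h)
        rw [mul_comm, mul_comm ((t + 1 : ℕ) : ℂ)]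
        exact_mod_cast this
      rw [smul_smul, smul_smul, h2, show t + (j + 1) = t + 1 + j by ring]
      congr 3
      push_cast
      ring_nf
    -- the annihilation operators: the same cancellation, by
    -- `(j+1) C(-r-1, j+1) = -(r+j+1) C(-r-1, j)`
    have d1 : ∀ r : ℕ, binom (-(r : ℤ) - 1) j •
          I (moduleY lam omega 0 v) (q - r - j - 1) (heis mu r u)
        = (-q) • (binom (-(r : ℤ) - 1) j • I v (q - 1 - r - j - 1) (heis mu r u))
          + ((r : ℂ) + j + 1) • binom (-(r : ℤ) - 1) j •
            I v (q - 1 - r - j - 1) (heis mu r u) := by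
      intro r
      rw [hv, show q - r - j - 1 - 1 = q - 1 - r - j - 1 by ring]
      module
    have d2 : ((j : ℂ) + 1) • ∑ᶠ r : ℕ, binom (-(r : ℤ) - 1) (j + 1) •
          I v (q - r - (j + 1 : ℕ) - 1) (heis mu r u)
        = - ∑ᶠ r : ℕ, ((r : ℂ) + j + 1) • binom (-(r : ℤ) - 1) j •
            I v (q - 1 - r - j - 1) (heis mu r u) := by
      rw [smul_finsum, ← finsum_neg_distrib]
      refine finsum_congr fun r => ?_
      rw [smul_smul, succ_mul_binom_succ, smul_smul, ← neg_smul,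
        show q - r - (j + 1 : ℕ) - 1 = q - 1 - r - j - 1 by push_cast; ring]
      congr 1
      push_cast
      ring
    rw [mul_comm v, moduleY_omega_zero_X_mul, map_add, map_smul, Pi.add_apply, Pi.smul_apply,
      LinearMap.add_apply, LinearMap.smul_apply, hI, latticeVertexOperator_X_mul lam mu j,
      latticeVertexOperator_X_mul lam mu (j + 1), latticeVertexOperator_X_mul lam mu j, ← hI,
      smul_add, smul_add, c2, d2]
    simp only [c1, d1]
    rw [finsum_sub_evZero (e1.smul _) e2, finsum_add_evZero (e3.smul _) e4, smul_finsum,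
      smul_finsum]
    abel

theorem latticeVertexOperator_mem_intertwining :
    latticeVertexOperator lam mu ∈ intertwining lam mu (lam + mu) := by
  refine ⟨fun v u n => ?_, jacobiIdentity_latticeVertexOperator lam mu, fun v n => ?_⟩
  · obtain ⟨B, hB⟩ := truncatedOp_latticeVertexOperator lam mu v u n
    exact eventually_atTop.mpr ⟨B, hB⟩
  · exact LinearMap.ext fun u => latticeVertexOperator_translation lam mu v n u

/-- The leading coefficient of `I(e^lam, z) e^mu` is `e^{lam+mu}`. -/
theorem latticeVertexOperator_one_one :
    latticeVertexOperator lam mu 1 (-(lam * mu) - 1) 1 = 1 := by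
  rw [latticeVertexOperator_apply lam mu 1 1 (k := 0) (by push_cast; ring)]
  exact vacuumCoeff_zero_one lam mu

end Translation

/-! ### The sign change `M(1, mu) ≅ M(1, -mu)` -/

section Involution

open MvPolynomial

variable (mu : ℂ)

theorem theta_X (j : ℕ) : theta (X j) = -X j := by simp [theta]

theorem theta_theta (u : MvPolynomial ℕ ℂ) : theta (theta u) = u := by
  have h : theta.comp theta = AlgHom.id ℂ (MvPolynomial ℕ ℂ) := by
    ext i
    simp [theta_X]
  exact DFunLike.congr_fun h u

/-- The sign change `h(-n₁) ⋯ h(-n_k) e^mu ↦ (-1)^k h(-n₁) ⋯ h(-n_k) e^{-mu}`. -/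
noncomputable def thetaEquiv : M1 mu ≃ₗ[ℂ] M1 (-mu) :=
  LinearEquiv.ofLinearMap theta.toLinearMap theta.toLinearMap (LinearMap.ext theta_theta)
    (LinearMap.ext theta_theta)

theorem theta_heis (m : ℤ) (u : MvPolynomial ℕ ℂ) :
    theta (heis mu m u) = -heis (-mu) m (theta u) := by
  induction u using MvPolynomial.induction_on with
  | C a =>
    have hC : theta (C a) = C a := theta.commutes a
    rw [hC]
    rcases lt_trichotomy m 0 with hm | rfl | hm
    · obtain ⟨k, rfl⟩ : ∃ k : ℕ, m = -(k : ℤ) - 1 := ⟨(-m - 1).toNat, by omega⟩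
      rw [heis_neg, heis_neg, map_mul, theta_X, hC, neg_mul]
    · rw [heis_zero, heis_zero, map_smul, hC, neg_smul, neg_neg]
    · obtain ⟨k, rfl⟩ : ∃ k : ℕ, m = (k : ℤ) + 1 := ⟨(m - 1).toNat, by omega⟩
      rw [heis_succ, heis_succ, pderiv_C, smul_zero, map_zero, neg_zero]
  | add p q hp hq => simp only [map_add, hp, hq, neg_add]
  | mul_X p j hp =>
    rw [mul_comm, heis_X_mul, map_add, map_mul, map_mul, hp, theta_X, neg_mul, neg_mul, map_neg,
      heis_X_mul, mul_neg]
    split_ifs <;> simp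

theorem theta_fockMode (a : MvPolynomial ℕ ℂ) :
    ∀ (n : ℤ) (u : MvPolynomial ℕ ℂ),
      theta (fockMode mu a n u) = fockMode (-mu) (theta a) n (theta u) := by
  induction a using MvPolynomial.induction_on with
  | C c =>
    intro n u
    have hc : (C c : MvPolynomial ℕ ℂ) = c • 1 := by rw [smul_eq_C_mul, mul_one]
    rw [hc, map_smul, map_one, fockMode_smul, fockMode_smul, LinearMap.smul_apply,
      LinearMap.smul_apply, map_smul, fockMode_one, fockMode_one]
    split_ifs <;> simp
  | add p q hp hq =>
    intro n u
    simp only [fockMode_add, map_add, LinearMap.add_apply, hp, hq]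
  | mul_X b j hb =>
    intro n u
    have hneg : fockMode (-mu) (-(X j * theta b)) n = -fockMode (-mu) (X j * theta b) n := by
      simp [fockMode]
    rw [mul_comm, map_mul, theta_X, neg_mul, hneg, LinearMap.neg_apply, fockMode_X_mul,
      fockMode_X_mul, neg_add, map_add, ← finsum_neg_distrib, ← finsum_neg_distrib]
    congr 1
    · refine (map_finsum_evZero (g := theta.toLinearMap)
        (((truncated_fockMode mu b u n).mul_left _).smul _)).trans (finsum_congr fun t => ?_)
      change theta _ = _
      rw [map_smul, map_mul, theta_X, hb, neg_mul, smul_neg]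
    · refine (map_finsum_evZero (g := theta.toLinearMap)
        ((((truncated_heis mu).nat u).map fun r : ℕ => fockMode mu b (n - r - j - 1)).smul
          _)).trans (finsum_congr fun r => ?_)
      change theta _ = _
      rw [map_smul, hb, theta_heis, map_neg, smul_neg]

theorem isModuleIso_thetaEquiv : IsModuleIso (moduleY mu) (moduleY (-mu)) (thetaEquiv mu) := by
  intro a n u
  refine (theta_fockMode mu a n u).trans ?_
  rw [show theta (a : M1 0) = a from a.2]
  rfl

/-- `M(1, mu) ≅ M(1, nu)` as `M(1)^+`-modules when `nu = ±mu`. -/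
theorem exists_isModuleIso_of_sq_eq {mu nu : ℂ} (h : nu ^ 2 = mu ^ 2) :
    ∃ g : M1 mu ≃ₗ[ℂ] M1 nu, IsModuleIso (moduleY mu) (moduleY nu) g := by
  rcases sq_eq_sq_iff_eq_or_eq_neg.mp h with rfl | rfl
  · exact ⟨LinearEquiv.refl ℂ _, fun a n u => rfl⟩
  · exact ⟨thetaEquiv mu, isModuleIso_thetaEquiv mu⟩

end Involution

/-! ### Composition with module homomorphisms -/

section Composition

variable {V M₁ M₂ M₃ N₂ N₃ : Type*}
  [AddCommGroup V] [Module ℂ V] [AddCommGroup M₁] [Module ℂ M₁]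
  [AddCommGroup M₂] [Module ℂ M₂] [AddCommGroup M₃] [Module ℂ M₃]
  [AddCommGroup N₂] [Module ℂ N₂] [AddCommGroup N₃] [Module ℂ N₃]

/-- Intertwining operators can be composed with module homomorphisms on both sides. -/
theorem compose_mem_intertwiningSpace {ω : V} {Y₁ : V →ₗ[ℂ] ℤ → Module.End ℂ M₁}
    {Y₂ : V →ₗ[ℂ] ℤ → Module.End ℂ M₂} {Y₃ : V →ₗ[ℂ] ℤ → Module.End ℂ M₃}
    {Z₂ : V →ₗ[ℂ] ℤ → Module.End ℂ N₂} {Z₃ : V →ₗ[ℂ] ℤ → Module.End ℂ N₃}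
    {I : M₁ →ₗ[ℂ] ℂ → M₂ →ₗ[ℂ] M₃} (hI : I ∈ intertwiningSpace ω Y₁ Y₂ Y₃)
    {g : M₃ →ₗ[ℂ] N₃} (hg : ∀ a n w, g (Y₃ a n w) = Z₃ a n (g w))
    {f : N₂ →ₗ[ℂ] M₂} (hf : ∀ a n u, f (Z₂ a n u) = Y₂ a n (f u)) :
    compose g I f ∈ intertwiningSpace ω Y₁ Z₂ Z₃ := by
  obtain ⟨h1, h2, h3⟩ := hI
  refine ⟨fun v u n => ?_, fun a v u l m n => ?_, fun v n => ?_⟩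
  · filter_upwards [h1 v (f u) n] with k hk
    simp [compose, hk]
  · filter_upwards [h2 a v (f u) l m n] with N hN
    have := congrArg g hN
    simp only [map_sub, map_sum, map_smul, hg, ← hf] at this
    exact this
  · ext u
    simp [compose, h3]

theorem rank_ne_zero_of_mem {E : Type*} [AddCommGroup E] [Module ℂ E] {S : Submodule ℂ E} {x : E}
    (hx : x ∈ S) (h0 : x ≠ 0) : Module.rank ℂ S ≠ 0 := by
  intro h
  have := rank_zero_iff.mp h
  exact h0 (congrArg Subtype.val (Subsingleton.elim (⟨x, hx⟩ : S) 0))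

theorem fusionRule_ne_zero_of_mem {ω : V} {Y₁ : V →ₗ[ℂ] ℤ → Module.End ℂ M₁}
    {Y₂ : V →ₗ[ℂ] ℤ → Module.End ℂ M₂} {Y₃ : V →ₗ[ℂ] ℤ → Module.End ℂ M₃}
    {I : M₁ →ₗ[ℂ] ℂ → M₂ →ₗ[ℂ] M₃} (hI : I ∈ intertwiningSpace ω Y₁ Y₂ Y₃) (h0 : I ≠ 0) :
    fusionRule ω Y₁ Y₂ Y₃ ≠ 0 :=
  rank_ne_zero_of_mem hI h0

end Composition

theorem compose_latticeVertexOperator_ne_zero {lam mu nu mu' : ℂ} (g : M1 (lam + mu) ≃ₗ[ℂ] M1 nu)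
    (f : M1 mu' →ₗ[ℂ] M1 mu) (hf : Function.Surjective f) :
    compose g.toLinearMap (latticeVertexOperator lam mu) f ≠ 0 := by
  intro h
  obtain ⟨u, hu⟩ := hf 1
  have h1 : g (latticeVertexOperator lam mu 1 (-(lam * mu) - 1) (f u)) = 0 :=
    DFunLike.congr_fun (congrFun (DFunLike.congr_fun h 1) (-(lam * mu) - 1)) u
  rw [hu, latticeVertexOperator_one_one, LinearEquiv.map_eq_zero_iff] at h1
  exact one_ne_zero h1

end FreeBoson

theorem proposition6p1 (lam mu nu : ℂ) :
    -- the fusion rule is nonzero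
    ((nu ^ 2 = (lam + mu) ^ 2 ∨ nu ^ 2 = (lam - mu) ^ 2) →
      fusionRule omega (moduleY lam) (moduleY mu)
        (moduleY nu) ≠ 0) ∧
    -- the lattice-type vertex operator is a nonzero intertwining operator
    (latticeVertexOperator lam mu ∈ intertwining lam mu (lam + mu) ∧
      latticeVertexOperator lam mu ≠ 0) ∧
    -- the modules with parameters `mu` and `-mu` are isomorphic
    (∃ f : M1 mu ≃ₗ[ℂ] M1 (-mu),
      IsModuleIso (moduleY mu) (moduleY (-mu)) f) ∧
    -- realisation for `nu ^ 2 = (lam + mu) ^ 2`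
    (nu ^ 2 = (lam + mu) ^ 2 →
      (∃ g : M1 (lam + mu) ≃ₗ[ℂ] M1 nu,
        IsModuleIso (moduleY (lam + mu)) (moduleY nu) g) ∧
      ∀ g : M1 (lam + mu) ≃ₗ[ℂ] M1 nu,
        IsModuleIso (moduleY (lam + mu)) (moduleY nu) g →
        compose g.toLinearMap (latticeVertexOperator lam mu) LinearMap.id
            ∈ intertwining lam mu nu ∧
          compose g.toLinearMap (latticeVertexOperator lam mu)
            LinearMap.id ≠ 0) ∧
    -- realisation for `nu ^ 2 = (lam - mu) ^ 2`
    (nu ^ 2 = (lam - mu) ^ 2 →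
      (∃ g : M1 (lam + -mu) ≃ₗ[ℂ] M1 nu,
        IsModuleIso (moduleY (lam + -mu)) (moduleY nu) g) ∧
      ∀ (f : M1 mu ≃ₗ[ℂ] M1 (-mu))
        (g : M1 (lam + -mu) ≃ₗ[ℂ] M1 nu),
        IsModuleIso (moduleY mu) (moduleY (-mu)) f →
        IsModuleIso (moduleY (lam + -mu)) (moduleY nu) g →
        compose g.toLinearMap (latticeVertexOperator lam (-mu))
            f.toLinearMap ∈ intertwining lam mu nu ∧
          compose g.toLinearMap (latticeVertexOperator lam (-mu))
            f.toLinearMap ≠ 0) := by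
  have hplus : ∀ g : M1 (lam + mu) ≃ₗ[ℂ] M1 nu,
      IsModuleIso (moduleY (lam + mu)) (moduleY nu) g →
      compose g.toLinearMap (latticeVertexOperator lam mu) LinearMap.id ∈ intertwining lam mu nu ∧
        compose g.toLinearMap (latticeVertexOperator lam mu) LinearMap.id ≠ 0 := fun g hg =>
    ⟨compose_mem_intertwiningSpace (latticeVertexOperator_mem_intertwining lam mu) hg
      fun _ _ _ => rfl,
      compose_latticeVertexOperator_ne_zero g _ Function.surjective_id⟩
  have hminus : ∀ (f : M1 mu ≃ₗ[ℂ] M1 (-mu)) (g : M1 (lam + -mu) ≃ₗ[ℂ] M1 nu),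
      IsModuleIso (moduleY mu) (moduleY (-mu)) f →
      IsModuleIso (moduleY (lam + -mu)) (moduleY nu) g →
      compose g.toLinearMap (latticeVertexOperator lam (-mu)) f.toLinearMap
          ∈ intertwining lam mu nu ∧
        compose g.toLinearMap (latticeVertexOperator lam (-mu)) f.toLinearMap ≠ 0 :=
    fun f g hf hg =>
    ⟨compose_mem_intertwiningSpace (latticeVertexOperator_mem_intertwining lam (-mu)) hg hf,
      compose_latticeVertexOperator_ne_zero g _ f.surjective⟩
  have hsub : nu ^ 2 = (lam - mu) ^ 2 → ∃ g : M1 (lam + -mu) ≃ₗ[ℂ] M1 nu,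
      IsModuleIso (moduleY (lam + -mu)) (moduleY nu) g := fun h =>
    exists_isModuleIso_of_sq_eq (by rw [h, sub_eq_add_neg])
  refine ⟨?_, ⟨latticeVertexOperator_mem_intertwining lam mu, fun h => ?_⟩,
    ⟨thetaEquiv mu, isModuleIso_thetaEquiv mu⟩,
    fun h => ⟨exists_isModuleIso_of_sq_eq h, hplus⟩, fun h => ⟨hsub h, hminus⟩⟩
  · rintro (h | h)
    · obtain ⟨g, hg⟩ := exists_isModuleIso_of_sq_eq h
      exact fusionRule_ne_zero_of_mem (hplus g hg).1 (hplus g hg).2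
    · obtain ⟨g, hg⟩ := hsub h
      have := hminus (thetaEquiv mu) g (isModuleIso_thetaEquiv mu) hg
      exact fusionRule_ne_zero_of_mem this.1 this.2
  · refine compose_latticeVertexOperator_ne_zero (lam := lam) (mu := mu) (mu' := mu)
      (LinearEquiv.refl ℂ _) LinearMap.id Function.surjective_id ?_
    rw [h]
    rfl
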